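/- Let $\mathbf A$ be a finite algebra with universe $A=\{0,\dots,n-1\}$ and basic operations $f_0,\dots,f_{k-1}$, where $k\ge 1$ and each $f_i$ has arity $m_i\ge 1$. Its size is $$\|\mathbf A\|=\sum_{i<k}|A|^{m_i}.$$ The algebra is idempotent if $f_i(a,\dots,a)=a$ for all $i$ and all $a\in A$. A Maltsev term operation of $\mathbf A$ is a ternary term operation $p$ of $\mathbf A$ with $p(x,x,y)=p(y,x,x)=y$ for all $x,y\in A$. A ternary circuit in the language of $\mathbf A$ is a finite directed acyclic graph (multiple edges allowed) whose vertices are three inputs $x_1,x_2,x_3$, which are sources, and finitely many gates. Each gate is labelled by a basic operation symbol and has an ordered list of incoming edges whose length is the arity of that symbol. One vertex is designated as the output. The size of the circuit is its number of vertices. A circuit computes a ternary operation on $A$ by evaluating each gate with the corresponding basic operation on the values of its in-neighbours. **Theorem.** There is an algorithm with the following property. Given a finite idempotent algebra $\mathbf A$ as above, presented by $n$, $k$, the arities and the tables of the basic operations, it halts after a number of steps that is bounded by a fixed polynomial in $\|\mathbf A\|$. It outputs either the statement that $\mathbf A$ has no Maltsev term operation, in which case this is true, or (a list of numbers describing) a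 circuit, of size bounded by a polynomial in $\|\mathbf A\|$, that computes a Maltsev term operation of $\mathbf A$. Here algorithms are programs for a random access machine storing natural numbers, with addition, truncated subtraction, indirect addressing and tests for zero, where every elementary instruction and every test costs one step. -/

import Mathlib

/-! ### Finite algebras given by operation tables -/

/-- A finite algebra with universe `{0, …, card - 1}` and finitely many basic operations. -/
structure FinAlgebra where
  /-- number of elements of the universe -/
  card : ℕ
  /-- number of basic operations -/
  numOps : ℕ
  /-- arities of the basic operations -/
  arity : Fin numOps → ℕ
  /-- the basic operations -/
  op : ∀ i : Fin numOps, (Fin (arity i) → Fin card) → Fin card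

namespace FinAlgebra

/-- The size `‖A‖ = ∑ kᵢ |A|ⁱ`, where `kᵢ` is the number of `i`-ary basic operations; equivalently
the total number of entries in the operation tables. -/
def size (A : FinAlgebra) : ℕ := ∑ i : Fin A.numOps, A.card ^ A.arity i

/-- Every basic operation satisfies `f(x, …, x) = x`. -/
def IsIdempotent (A : FinAlgebra) : Prop :=
  ∀ (i : Fin A.numOps) (a : Fin A.card), A.op i (fun _ => a) = a

/-- The algebraic language of `A`: one operation symbol for each basic operation. -/
def lang (A : FinAlgebra) : FirstOrder.Language where
  Functions m := {i : Fin A.numOps // A.arity i = m}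
  Relations _ := Empty

instance instLangStructure (A : FinAlgebra) : A.lang.Structure (Fin A.card) where
  funMap := fun {_} f x => A.op f.1 (fun j => x (Fin.cast f.2 j))
  RelMap := fun {_} r _ => Empty.elim r

/-- `f` is the interpretation in `A` of a term in the variables `x₀, …, x_{m-1}`. -/
def IsTermOp (A : FinAlgebra) {m : ℕ} (f : (Fin m → Fin A.card) → Fin A.card) : Prop :=
  ∃ t : A.lang.Term (Fin m), ∀ x : Fin m → Fin A.card, t.realize x = f x

/-- `f` is a Maltsev term operation of `A`: a ternary term operation such that
`f(x, x, y) = f(y, x, x) = y` for all `x, y`. -/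
def IsMaltsevTermOp (A : FinAlgebra) (f : (Fin 3 → Fin A.card) → Fin A.card) : Prop :=
  A.IsTermOp f ∧ ∀ x y : Fin A.card, f ![x, x, y] = y ∧ f ![y, x, x] = y

/-- The table of the `i`-th basic operation, as the list of its `card ^ arity i` values. The value
at `(x₀, …, x_{m-1})` stands at position `∑ xⱼ * card ^ j`. -/
def table (A : FinAlgebra) (i : Fin A.numOps) : List ℕ :=
  List.ofFn fun e : Fin (A.card ^ A.arity i) => (A.op i (finFunctionFinEquiv.symm e) : ℕ)

/-- The input presenting `A`: the number of elements, the number of basic operations, their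
arities, and then their tables one after another. -/
def code (A : FinAlgebra) : List ℕ :=
  A.card :: A.numOps :: (List.ofFn A.arity ++ (List.finRange A.numOps).flatMap A.table)

/-! ### Circuits -/

/-- An `m`-ary circuit in the language of `A`: a finite directed acyclic graph, possibly with
multiple edges. Its vertices are the `m` inputs (the left summand) and the gates (the right
summand). Each gate carries an operation symbol and an ordered list of in-neighbours whose length
is the arity of the symbol, and one vertex is the output. -/
structure Circuit (A : FinAlgebra) (m : ℕ) where
  numGates : ℕ
  label : Fin numGates → Fin A.numOps
  inNbr : ∀ g : Fin numGates, Fin (A.arity (label g)) → Fin m ⊕ Fin numGates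
  output : Fin m ⊕ Fin numGates
  /-- there is no directed cycle -/
  acyclic : ∀ v : Fin m ⊕ Fin numGates,
    ¬ Relation.TransGen (fun u w => ∃ g, w = Sum.inr g ∧ ∃ j, inNbr g j = u) v v

namespace Circuit

variable {A : FinAlgebra} {m : ℕ}

/-- There is an edge from the vertex `u` to the vertex `w`. -/
def Edge (C : A.Circuit m) (u w : Fin m ⊕ Fin C.numGates) : Prop :=
  ∃ g, w = Sum.inr g ∧ ∃ j, C.inNbr g j = u

theorem wellFounded_edge (C : A.Circuit m) : WellFounded C.Edge := by
  have : Std.Irrefl (Relation.TransGen C.Edge) := ⟨C.acyclic⟩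
  have h : WellFounded (Relation.TransGen C.Edge) :=
    Finite.wellFounded_of_trans_of_irrefl _
  exact Subrelation.wf (fun h' => Relation.TransGen.single h') h

/-- The number of vertices. -/
def size (C : A.Circuit m) : ℕ := m + C.numGates

/-- The value of every vertex on the input tuple `x`, computed recursively along the edges. -/
noncomputable def value (C : A.Circuit m) (x : Fin m → Fin A.card) :
    Fin m ⊕ Fin C.numGates → Fin A.card :=
  C.wellFounded_edge.fix fun v ih =>
    match v, ih with
    | Sum.inl i, _ => x i
    | Sum.inr g, ih => A.op (C.label g) fun j => ih (C.inNbr g j) ⟨g, rfl, j, rfl⟩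

theorem value_input (C : A.Circuit m) (x : Fin m → Fin A.card) (i : Fin m) :
    C.value x (Sum.inl i) = x i := by
  rw [value, WellFounded.fix_eq]

theorem value_gate (C : A.Circuit m) (x : Fin m → Fin A.card) (g : Fin C.numGates) :
    C.value x (Sum.inr g) = A.op (C.label g) fun j => C.value x (C.inNbr g j) := by
  rw [value, WellFounded.fix_eq]

/-- The operation computed by the circuit. -/
noncomputable def fn (C : A.Circuit m) (x : Fin m → Fin A.card) : Fin A.card :=
  C.value x C.output

/-- The number naming a vertex: inputs are `0, …, m - 1`, and gates are numbered from `m` on. -/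
def vertexCode (C : A.Circuit m) : Fin m ⊕ Fin C.numGates → ℕ
  | Sum.inl i => i
  | Sum.inr g => m + g

/-- The description of a circuit by a list of numbers: the number of gates, then for each gate its
operation symbol followed by its in-neighbours in order, then the output vertex. -/
def code (C : A.Circuit m) : List ℕ :=
  C.numGates ::
    ((List.finRange C.numGates).flatMap
        (fun g => (C.label g : ℕ) :: List.ofFn fun j => C.vertexCode (C.inNbr g j))
      ++ [C.vertexCode C.output])

end Circuit

end FinAlgebra

/-! ### Random access machines

Structured programs for a random access machine with addition and truncated subtraction. Every
elementary instruction and every test of a register costs one step. There is no multiplication, so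
each step increases the bit length of the largest stored number by at most one, and polynomial time
in this model is the same as polynomial time on Turing machines. -/

namespace RAM

/-- A machine configuration: registers, arrays (`mem a k` is the `k`-th cell of the `a`-th array),
and the output written so far. A program mentions only finitely many registers and arrays. -/
structure State where
  reg : ℕ → ℕ
  mem : ℕ → ℕ → ℕ
  out : List ℕ

/-- Elementary instructions. -/
inductive Instr where
  /-- `reg r := c` -/
  | const (r c : ℕ)
  /-- `reg r := reg s + reg t` -/
  | add (r s t : ℕ)
  /-- `reg r := reg s - reg t`, or `0` if `reg s < reg t` -/
  | sub (r s t : ℕ)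
  /-- `reg r := mem a (reg s)` -/
  | load (r a s : ℕ)
  /-- `mem a (reg s) := reg r` -/
  | store (a s r : ℕ)
  /-- append `reg r` to the output -/
  | write (r : ℕ)

/-- The effect of an elementary instruction. -/
def Instr.apply : Instr → State → State
  | .const r c, σ => { σ with reg := Function.update σ.reg r c }
  | .add r s t, σ => { σ with reg := Function.update σ.reg r (σ.reg s + σ.reg t) }
  | .sub r s t, σ => { σ with reg := Function.update σ.reg r (σ.reg s - σ.reg t) }
  | .load r a s, σ => { σ with reg := Function.update σ.reg r (σ.mem a (σ.reg s)) }
  | .store a s r, σ =>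
      { σ with mem := Function.update σ.mem a (Function.update (σ.mem a) (σ.reg s) (σ.reg r)) }
  | .write r, σ => { σ with out := σ.out ++ [σ.reg r] }

/-- Programs. -/
inductive Prog where
  | instr (i : Instr)
  /-- first `p`, then `q` -/
  | seq (p q : Prog)
  /-- if `reg r ≠ 0` then `p` else `q` -/
  | cond (r : ℕ) (p q : Prog)
  /-- while `reg r ≠ 0` do `p` -/
  | loop (r : ℕ) (p : Prog)

/-- `Exec P σ τ t`: started in `σ`, the program `P` halts in the configuration `τ` after exactly
`t` steps. -/
inductive Exec : Prog → State → State → ℕ → Prop where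
  | instr (i : Instr) (σ : State) : Exec (.instr i) σ (i.apply σ) 1
  | seq {p q : Prog} {σ τ ρ : State} {t u : ℕ} :
      Exec p σ τ t → Exec q τ ρ u → Exec (.seq p q) σ ρ (t + u)
  | cond_true {r : ℕ} {p q : Prog} {σ τ : State} {t : ℕ} :
      σ.reg r ≠ 0 → Exec p σ τ t → Exec (.cond r p q) σ τ (t + 1)
  | cond_false {r : ℕ} {p q : Prog} {σ τ : State} {t : ℕ} :
      σ.reg r = 0 → Exec q σ τ t → Exec (.cond r p q) σ τ (t + 1)
  | loop_done {r : ℕ} {p : Prog} {σ : State} :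
      σ.reg r = 0 → Exec (.loop r p) σ σ 1
  | loop_step {r : ℕ} {p : Prog} {σ τ ρ : State} {t u : ℕ} :
      σ.reg r ≠ 0 → Exec p σ τ t → Exec (.loop r p) τ ρ u → Exec (.loop r p) σ ρ (t + u + 1)

/-- Execution is deterministic: the final configuration and the running time are unique. -/
theorem Exec.unique {P : Prog} {σ τ τ' : State} {t t' : ℕ}
    (h : Exec P σ τ t) (h' : Exec P σ τ' t') : τ = τ' ∧ t = t' := by
  induction h generalizing τ' t' with
  | instr i σ => cases h'; exact ⟨rfl, rfl⟩
  | seq _ _ ih₁ ih₂ =>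
    cases h' with
    | seq a b =>
      obtain ⟨rfl, rfl⟩ := ih₁ a
      obtain ⟨rfl, rfl⟩ := ih₂ b
      exact ⟨rfl, rfl⟩
  | cond_true hr _ ih =>
    cases h' with
    | cond_true _ a => obtain ⟨rfl, rfl⟩ := ih a; exact ⟨rfl, rfl⟩
    | cond_false h0 _ => exact absurd h0 hr
  | cond_false hr _ ih =>
    cases h' with
    | cond_true h0 _ => exact absurd hr h0
    | cond_false _ a => obtain ⟨rfl, rfl⟩ := ih a; exact ⟨rfl, rfl⟩
  | loop_done hr =>
    cases h' with
    | loop_done _ => exact ⟨rfl, rfl⟩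
    | loop_step h0 _ _ => exact absurd hr h0
  | loop_step hr _ _ ih₁ ih₂ =>
    cases h' with
    | loop_done h0 => exact absurd h0 hr
    | loop_step _ a b =>
      obtain ⟨rfl, rfl⟩ := ih₁ a
      obtain ⟨rfl, rfl⟩ := ih₂ b
      exact ⟨rfl, rfl⟩

/-- The initial configuration on the input `w`: array `0` holds `w` from cell `0` on, everything
else is zero, and nothing has been written. -/
def init (w : List ℕ) : State where
  reg := fun _ => 0
  mem := fun a k => if a = 0 then w.getD k 0 else 0
  out := []

end RAM

/-! Write n for the number of elements. A ternary term is corrected at one pair at a time. Keep a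
term t with t(x,x,y) = y everywhere and t(a,b,b) = a at the pairs (a,b) treated so far. The third
projection is a start, and t is Maltsev once all n² pairs are treated.

To treat one more pair (a,b), start from the first projection q, for which q(x,y,y) = x everywhere,
and repair q(c,c,d) = d for one pair (c,d) after another. Two companions are carried along: q1,
which equals t on triples (x,y,y) and q on triples (x,x,y), and q2(x,y,z) = q(x,y,y). With tR(x,y,z)
= t(x,y,y), a repair takes a term r such that r(q,q1,t) has value a at (a,b,b) and d at (c,c,d), and
replaces q, q1, q2 by r(q,q1,t), r(q1,q1,t), r(q2,tR,tR). At every place treated earlier the three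
arguments of r coincide, so idempotence preserves what was achieved (`Inner.step`). When all (c,d)
are done, q is the next t (`Outer.step`).

Such an r exists iff (a,d) lies in the subalgebra of A² generated by the values of q, q1, t at the
two triples. A Maltsev term p would serve as r: at (a,b,b) the first argument is a and the other two
agree, and at (c,c,d) the first two agree and the third is d. So a failed search proves that there
is no Maltsev term (`mem_stage_of_isMaltsevTermOp`).

The subalgebra has at most n² elements, so n² passes generate it (`stage_stable`, `passes_spec`).
Tuples of pairs for an m-ary operation correspond to pairs of positions in its table, so there are
at most ‖A‖² of them. The term r is never written out: every generated pair carries three vertices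
of one growing circuit, which compute r under the three substitutions (`Entry`). Each application
costs three gates, and sharing them over all n⁴ rounds keeps the circuit polynomial.

For the machine, the algorithm is written in a language of bounded loops (`Stmt`) with a
denotational semantics, and compiled. By `Stmt.comp_runs` the running time is polynomial in any
bound for the loop ranges and the other numbers governing arithmetic cost. `Spec` combines this
safety condition with functional correctness. -/

set_option linter.unusedSimpArgs false

/-! ### A verified compiler from bounded-loop programs to the machine -/

namespace RAM

namespace State

/-- Change one register. -/
def setReg (σ : State) (r v : ℕ) : State := { σ with reg := Function.update σ.reg r v }

/-- Change one cell of an array. -/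
def setMem (σ : State) (a i v : ℕ) : State :=
  { σ with mem := Function.update σ.mem a (Function.update (σ.mem a) i v) }

/-- Append a number to the output. -/
def emit (σ : State) (v : ℕ) : State := { σ with out := σ.out ++ [v] }

variable (σ : State) (r r' a a' i i' v : ℕ)

@[simp] theorem setReg_reg : (σ.setReg r v).reg r' = if r' = r then v else σ.reg r' := by
  simp [setReg, Function.update_apply]
@[simp] theorem setReg_mem : (σ.setReg r v).mem = σ.mem := rfl
@[simp] theorem setReg_out : (σ.setReg r v).out = σ.out := rfl
@[simp] theorem setMem_reg : (σ.setMem a i v).reg = σ.reg := rfl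
@[simp] theorem setMem_out : (σ.setMem a i v).out = σ.out := rfl
@[simp] theorem setMem_mem : (σ.setMem a i v).mem a' =
    if a' = a then Function.update (σ.mem a) i v else σ.mem a' := by
  simp [setMem, Function.update_apply]
@[simp] theorem emit_reg : (σ.emit v).reg = σ.reg := rfl
@[simp] theorem emit_mem : (σ.emit v).mem = σ.mem := rfl
@[simp] theorem emit_out : (σ.emit v).out = σ.out ++ [v] := rfl

/-- Two configurations agree except on the registers from `d` on. -/
structure Agree (d : ℕ) (σ τ : State) : Prop where
  reg : ∀ r < d, σ.reg r = τ.reg r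
  mem : σ.mem = τ.mem
  out : σ.out = τ.out

variable {σ} {τ ρ : State} {d d' : ℕ}

theorem Agree.refl (d : ℕ) (σ : State) : Agree d σ σ := ⟨fun _ _ => rfl, rfl, rfl⟩

theorem Agree.trans (h : Agree d σ τ) (h' : Agree d τ ρ) : Agree d σ ρ :=
  ⟨fun r hr => (h.reg r hr).trans (h'.reg r hr), h.mem.trans h'.mem, h.out.trans h'.out⟩

theorem Agree.mono (h : Agree d σ τ) (hd : d' ≤ d) : Agree d' σ τ :=
  ⟨fun r hr => h.reg r (hr.trans_le hd), h.mem, h.out⟩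

theorem Agree.setReg_right {r : ℕ} (h : Agree d σ τ) (hr : d ≤ r) (v : ℕ) :
    Agree d σ (τ.setReg r v) :=
  ⟨fun s hs => by simp [h.reg s hs, (hs.trans_le hr).ne], h.mem, h.out⟩

theorem Agree.setReg (h : Agree d σ τ) (r v : ℕ) : Agree d (σ.setReg r v) (τ.setReg r v) :=
  ⟨fun s hs => by simp [h.reg s hs], h.mem, h.out⟩

end State

open State

/-- `P` runs from `σ` within `T` steps and ends in a configuration satisfying `Q`. -/
def Runs (P : Prog) (σ : State) (T : ℕ) (Q : State → Prop) : Prop :=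
  ∃ τ t, Exec P σ τ t ∧ t ≤ T ∧ Q τ

section Runs

variable {P P' : Prog} {σ : State} {T T' : ℕ} {Q R : State → Prop}

theorem Runs.mono (h : Runs P σ T Q) (hT : T ≤ T') (hQ : ∀ τ, Q τ → R τ) : Runs P σ T' R := by
  obtain ⟨τ, t, he, ht, hq⟩ := h
  exact ⟨τ, t, he, ht.trans hT, hQ τ hq⟩

theorem Runs.seq (h : Runs P σ T R) (h' : ∀ τ, R τ → Runs P' τ T' Q) :
    Runs (.seq P P') σ (T + T') Q := by
  obtain ⟨τ, t, he, ht, hr⟩ := h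
  obtain ⟨ρ, u, he', hu, hq⟩ := h' τ hr
  exact ⟨ρ, _, .seq he he', by lia, hq⟩

theorem Runs.instr {i : Instr} (h : Q (i.apply σ)) : Runs (.instr i) σ 1 Q :=
  ⟨_, _, .instr i σ, le_rfl, h⟩

theorem Runs.instr_seq {i : Instr} (h : Runs P (i.apply σ) T Q) :
    Runs (.seq (.instr i) P) σ (T + 1) Q := by
  rw [add_comm]
  exact Runs.seq (Runs.instr (Q := fun τ => τ = i.apply σ) rfl) (by rintro _ rfl; exact h)

/-- A loop whose test register takes the values `k, k - 1, …, 0`. -/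
theorem Runs.loop {r : ℕ} (I : ℕ → State → Prop) (k : ℕ)
    (hr : ∀ j τ, I j τ → (τ.reg r = 0 ↔ j = 0))
    (hstep : ∀ j τ, j < k → I (j + 1) τ → Runs P τ T (I j)) (h : I k σ) :
    Runs (.loop r P) σ (k * (T + 1) + 1) (I 0) := by
  induction k generalizing σ with
  | zero => exact ⟨σ, 1, .loop_done ((hr 0 σ h).2 rfl), by simp, h⟩
  | succ k ih =>
    obtain ⟨τ, t, he, ht, hτ⟩ := hstep k σ (by lia) h
    obtain ⟨ρ, u, he', hu, hρ⟩ := ih (fun j τ hj => hstep j τ (by lia)) hτ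
    refine ⟨ρ, _, .loop_step (fun h0 => ?_) he he', ?_, hρ⟩
    · exact absurd ((hr _ _ h).1 h0) (by simp)
    · rw [Nat.succ_mul]; lia

end Runs

/-! ### Expressions -/

/-- Arithmetic expressions in registers and array cells. -/
inductive Ex where
  | var (r : ℕ)
  | lit (c : ℕ)
  | add (e f : Ex)
  | sub (e f : Ex)
  | mul (e f : Ex)
  | div (e f : Ex)
  | mod (e f : Ex)
  | load (a : ℕ) (e : Ex)

namespace Ex

instance : Add Ex := ⟨add⟩
instance : Sub Ex := ⟨sub⟩
instance : Mul Ex := ⟨mul⟩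
instance : Div Ex := ⟨div⟩
instance : Mod Ex := ⟨mod⟩
instance (c : ℕ) : OfNat Ex c := ⟨lit c⟩

/-- The value of an expression. -/
def eval (σ : State) : Ex → ℕ
  | var r => σ.reg r
  | lit c => c
  | add e f => e.eval σ + f.eval σ
  | sub e f => e.eval σ - f.eval σ
  | mul e f => e.eval σ * f.eval σ
  | div e f => e.eval σ / f.eval σ
  | mod e f => e.eval σ % f.eval σ
  | load a e => σ.mem a (e.eval σ)

/-- All registers read by the expression are below `d`. -/
def usesBelow (d : ℕ) : Ex → Bool
  | var r => decide (r < d)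
  | lit _ => true
  | add e f | sub e f | mul e f | div e f | mod e f => e.usesBelow d && f.usesBelow d
  | load _ e => e.usesBelow d

/-- The factors and dividends that control the running time are at most `B`, and no divisor
vanishes. -/
def Safe (B : ℕ) (σ : State) : Ex → Prop
  | var _ => True
  | lit _ => True
  | add e f | sub e f => e.Safe B σ ∧ f.Safe B σ
  | mul e f => e.Safe B σ ∧ f.Safe B σ ∧ e.eval σ ≤ B
  | div e f | mod e f => e.Safe B σ ∧ f.Safe B σ ∧ e.eval σ ≤ B ∧ 0 < f.eval σ
  | load _ e => e.Safe B σ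

section simp

variable (σ : State) (B r c a : ℕ) (e f : Ex)

@[simp] theorem eval_var : (var r).eval σ = σ.reg r := rfl
@[simp] theorem eval_lit : (lit c).eval σ = c := rfl
@[simp] theorem eval_ofNat : (no_index (OfNat.ofNat c : Ex)).eval σ = OfNat.ofNat c := rfl
@[simp] theorem eval_add : (e + f).eval σ = e.eval σ + f.eval σ := rfl
@[simp] theorem eval_sub : (e - f).eval σ = e.eval σ - f.eval σ := rfl
@[simp] theorem eval_mul : (e * f).eval σ = e.eval σ * f.eval σ := rfl
@[simp] theorem eval_div : (e / f).eval σ = e.eval σ / f.eval σ := rfl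
@[simp] theorem eval_mod : (e % f).eval σ = e.eval σ % f.eval σ := rfl
@[simp] theorem eval_load : (load a e).eval σ = σ.mem a (e.eval σ) := rfl
@[simp] theorem safe_var : (var r).Safe B σ := trivial
@[simp] theorem safe_lit : (lit c).Safe B σ := trivial
@[simp] theorem safe_ofNat : (no_index (OfNat.ofNat c : Ex)).Safe B σ := trivial
@[simp] theorem safe_add : (e + f).Safe B σ ↔ e.Safe B σ ∧ f.Safe B σ := Iff.rfl
@[simp] theorem safe_sub : (e - f).Safe B σ ↔ e.Safe B σ ∧ f.Safe B σ := Iff.rfl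
@[simp] theorem safe_mul : (e * f).Safe B σ ↔ e.Safe B σ ∧ f.Safe B σ ∧ e.eval σ ≤ B := Iff.rfl
@[simp] theorem safe_div :
    (e / f).Safe B σ ↔ e.Safe B σ ∧ f.Safe B σ ∧ e.eval σ ≤ B ∧ 0 < f.eval σ := Iff.rfl
@[simp] theorem safe_mod :
    (e % f).Safe B σ ↔ e.Safe B σ ∧ f.Safe B σ ∧ e.eval σ ≤ B ∧ 0 < f.eval σ := Iff.rfl
@[simp] theorem safe_load : (load a e).Safe B σ ↔ e.Safe B σ := Iff.rfl

end simp

/-- Division with remainder of register `d` by register `d + 1`; the quotient is left in register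
`d + 2` and the remainder in register `d + 3`, and register `d` is cleared. -/
def divMod (d : ℕ) : Prog :=
  .seq (.instr (.const (d + 2) 0)) <| .seq (.instr (.const (d + 3) 0)) <|
  .seq (.instr (.const (d + 4) 1)) <|
  .loop d <| .seq (.instr (.add (d + 3) (d + 3) (d + 4))) <|
    .seq (.instr (.sub (d + 5) (d + 1) (d + 3))) <|
    .seq (.instr (.sub d d (d + 4))) <|
    .cond (d + 5) (.instr (.sub (d + 5) d d))
      (.seq (.instr (.add (d + 2) (d + 2) (d + 4))) (.instr (.const (d + 3) 0)))

/-- The product of the registers `d` and `d + 1` is left in register `d + 2`, and register `d` is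
cleared. -/
def mulLoop (d : ℕ) : Prog :=
  .seq (.instr (.const (d + 2) 0)) <| .seq (.instr (.const (d + 3) 1)) <|
  .loop d <| .seq (.instr (.add (d + 2) (d + 2) (d + 1))) (.instr (.sub d d (d + 3)))

/-- Compilation: the value is left in register `d`, and no register below `d` is changed. -/
def comp : Ex → ℕ → Prog
  | var r, d => .seq (.instr (.const d 0)) (.instr (.add d r d))
  | lit c, d => .instr (.const d c)
  | add e f, d => .seq (e.comp d) <| .seq (f.comp (d + 1)) (.instr (.add d d (d + 1)))
  | sub e f, d => .seq (e.comp d) <| .seq (f.comp (d + 1)) (.instr (.sub d d (d + 1)))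
  | mul e f, d => .seq (e.comp d) <| .seq (f.comp (d + 1)) <| .seq (mulLoop d)
      (.instr (.add d d (d + 2)))
  | div e f, d => .seq (e.comp d) <| .seq (f.comp (d + 1)) <| .seq (divMod d)
      (.instr (.add d d (d + 2)))
  | mod e f, d => .seq (e.comp d) <| .seq (f.comp (d + 1)) <| .seq (divMod d)
      (.instr (.add d d (d + 3)))
  | load a e, d => .seq (e.comp d) (.instr (.load d a d))

/-- A bound for the running time of the compiled expression. -/
def cost (B : ℕ) : Ex → ℕ
  | var _ => 2
  | lit _ => 1
  | add e f | sub e f => e.cost B + (f.cost B + 1)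
  | mul e f => e.cost B + (f.cost B + (B * 3 + 1 + 1 + 1 + 1))
  | div e f | mod e f => e.cost B + (f.cost B + (B * 7 + 1 + 1 + 1 + 1 + 1))
  | load _ e => e.cost B + 1

theorem usesBelow_mono {e : Ex} {d d' : ℕ} (h : e.usesBelow d) (hd : d ≤ d') : e.usesBelow d' := by
  induction e <;> simp_all [usesBelow]
  lia

theorem eval_congr {e : Ex} {d : ℕ} {σ τ : State} (h : e.usesBelow d) (hs : Agree d σ τ) :
    e.eval σ = e.eval τ := by
  induction e <;> simp_all [usesBelow, eval, hs.mem]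
  exact hs.reg _ h

theorem safe_congr {e : Ex} {d B : ℕ} {σ τ : State} (h : e.usesBelow d) (hs : Agree d σ τ)
    (hB : e.Safe B σ) : e.Safe B τ := by
  induction e <;> simp_all [usesBelow, Safe]
  all_goals
    rw [← eval_congr h.1 hs]
    try rw [← eval_congr h.2 hs]
    simp [hB]

theorem mulLoop_runs {d B : ℕ} {σ : State} (hB : σ.reg d ≤ B) :
    Runs (mulLoop d) σ (B * 3 + 1 + 1 + 1)
      fun τ => Agree d σ τ ∧ τ.reg d = 0 ∧ τ.reg (d + 2) = σ.reg d * σ.reg (d + 1) := by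
  refine Runs.instr_seq (Runs.instr_seq ?_)
  -- Invariant: the partial sum plus the outstanding `j` copies of the second factor is the product.
  refine (Runs.loop (T := 2) (fun j τ => Agree d σ τ ∧ τ.reg d = j ∧ τ.reg (d + 1) = σ.reg (d + 1) ∧
    τ.reg (d + 3) = 1 ∧ τ.reg (d + 2) + j * σ.reg (d + 1) = σ.reg d * σ.reg (d + 1)) (σ.reg d)
    (fun j τ h => by rw [h.2.1]) ?_ ?_).mono (by gcongr) ?_
  · rintro j τ hj ⟨h1, h2, h3, h4, h5⟩
    refine Runs.instr_seq (Runs.instr ⟨?_, ?_⟩)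
    · refine ⟨fun r hr => ?_, h1.mem, h1.out⟩
      simp [Instr.apply, Function.update_apply, h1.reg r hr, hr.ne, (show r ≠ d + 2 by lia)]
    · simp only [Instr.apply, Function.update_apply]
      simp [h2, h3, h4]
      rw [← h5]; ring
  · refine ⟨⟨fun r hr => ?_, rfl, rfl⟩, ?_⟩
    · simp [Instr.apply, Function.update_apply, (show r ≠ d + 2 by lia), (show r ≠ d + 3 by lia)]
    · simp [Instr.apply, Function.update_apply]
  · rintro τ ⟨h1, h2, h3, h4, h5⟩
    exact ⟨h1, h2, by simpa using h5⟩

theorem divMod_runs {d B : ℕ} {σ : State} (hB : σ.reg d ≤ B) (h0 : 0 < σ.reg (d + 1)) :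
    Runs (divMod d) σ (B * 7 + 1 + 1 + 1 + 1)
      fun τ => Agree d σ τ ∧ τ.reg d = 0 ∧ τ.reg (d + 2) = σ.reg d / σ.reg (d + 1) ∧
        τ.reg (d + 3) = σ.reg d % σ.reg (d + 1) := by
  refine Runs.instr_seq (Runs.instr_seq (Runs.instr_seq ?_))
  -- The dividend is counted down by ones. The remainder counter is reset, and the quotient raised,
  -- whenever it would reach the divisor; hence remainder plus divisor times quotient plus `j` is
  -- constant.
  refine (Runs.loop (T := 6) (fun j τ => Agree d σ τ ∧ τ.reg d = j ∧ τ.reg (d + 1) = σ.reg (d + 1) ∧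
    τ.reg (d + 4) = 1 ∧ τ.reg (d + 3) < σ.reg (d + 1) ∧
    τ.reg (d + 3) + σ.reg (d + 1) * τ.reg (d + 2) + j = σ.reg d) (σ.reg d)
    (fun j τ h => by rw [h.2.1]) ?_ ?_).mono (by gcongr) ?_
  · rintro j τ hj ⟨h1, h2, h3, h4, h5, h6⟩
    refine Runs.instr_seq (Runs.instr_seq (Runs.instr_seq ?_))
    by_cases hc : σ.reg (d + 1) - (τ.reg (d + 3) + 1) = 0
    · obtain ⟨ρ, u, he, hu, hρ⟩ : Runs (.seq (.instr (.add (d + 2) (d + 2) (d + 4)))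
        (.instr (.const (d + 3) 0))) _ 2 _ := Runs.instr_seq (Runs.instr rfl)
      refine ⟨ρ, _, .cond_false ?_ he, by lia, ?_⟩
      · simpa [Instr.apply, Function.update_apply, h3, h4] using hc
      subst hρ
      refine ⟨⟨fun r hr => ?_, h1.mem, h1.out⟩, ?_⟩
      · simp [Instr.apply, Function.update_apply, h1.reg r hr, hr.ne, (show r ≠ d + 2 by lia),
          (show r ≠ d + 3 by lia), (show r ≠ d + 5 by lia)]
      · simp [Instr.apply, Function.update_apply, h2, h3, h4, h0]
        rw [← h6, show σ.reg (d + 1) = τ.reg (d + 3) + 1 by lia]; ring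
    · refine ⟨_, _, .cond_true ?_ (.instr _ _), by lia, ?_⟩
      · simpa [Instr.apply, Function.update_apply, h3, h4] using hc
      refine ⟨⟨fun r hr => ?_, h1.mem, h1.out⟩, ?_⟩
      · simp [Instr.apply, Function.update_apply, h1.reg r hr, hr.ne, (show r ≠ d + 2 by lia),
          (show r ≠ d + 3 by lia), (show r ≠ d + 5 by lia)]
      · simp [Instr.apply, Function.update_apply, h2, h3, h4]
        exact ⟨by lia, by rw [← h6]; ring⟩
  · refine ⟨⟨fun r hr => ?_, rfl, rfl⟩, ?_⟩
    · simp [Instr.apply, Function.update_apply, (show r ≠ d + 2 by lia), (show r ≠ d + 3 by lia),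
        (show r ≠ d + 4 by lia)]
    · simp [Instr.apply, Function.update_apply, h0]
  · rintro τ ⟨h1, h2, h3, h4, h5, h6⟩
    have := (Nat.div_mod_unique (d := τ.reg (d + 2)) (c := τ.reg (d + 3)) h0).2 ⟨by simpa using h6, h5⟩
    exact ⟨h1, h2, this.1.symm, this.2.symm⟩

/-- Evaluating two operands one after the other. -/
theorem comp_two {e f : Ex} {d T U V : ℕ} {σ : State} {P : Prog} {Q : State → Prop}
    (hef : f.usesBelow d)
    (he : Runs (e.comp d) σ T fun τ => Agree d σ τ ∧ τ.reg d = e.eval σ)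
    (hf : ∀ τ, Agree d σ τ → Runs (f.comp (d + 1)) τ U
      fun ρ => Agree (d + 1) τ ρ ∧ ρ.reg (d + 1) = f.eval τ)
    (hP : ∀ τ, Agree d σ τ → τ.reg d = e.eval σ → τ.reg (d + 1) = f.eval σ → Runs P τ V Q) :
    Runs (.seq (e.comp d) (.seq (f.comp (d + 1)) P)) σ (T + (U + V)) Q := by
  refine he.seq fun τ hτ => (hf τ hτ.1).seq fun ρ hρ => hP ρ (hτ.1.trans (hρ.1.mono (by lia))) ?_ ?_
  · rw [← hτ.2, hρ.1.reg d (by lia)]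
  · rw [hρ.2, eval_congr hef hτ.1]

/-- The registers from `d` on act as a stack: the second operand is evaluated one register higher,
so the first value survives. -/
theorem comp_runs {e : Ex} {B d : ℕ} {σ : State} (h : e.usesBelow d) (hs : e.Safe B σ) :
    Runs (e.comp d) σ (e.cost B) fun τ => Agree d σ τ ∧ τ.reg d = e.eval σ := by
  have key : ∀ (τ : State) (v : ℕ), Agree d σ τ →
      Agree d σ { τ with reg := Function.update τ.reg d v } := fun τ v hτ =>
    ⟨fun r hr => by simp [Function.update_apply, hτ.reg r hr, hr.ne], hτ.mem, hτ.out⟩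
  induction e generalizing d σ with
  | var r =>
    have hr : r ≠ d := by simp [usesBelow] at h; lia
    exact Runs.instr_seq (Runs.instr ⟨key _ _ (key _ _ (.refl _ _)),
      by simp [Instr.apply, Function.update_apply, hr]⟩)
  | lit c => exact Runs.instr ⟨key _ _ (.refl _ _), by simp [Instr.apply]⟩
  | load a e ih =>
    refine (ih h hs key).seq fun τ hτ => Runs.instr ⟨key _ _ hτ.1, ?_⟩
    simp [Instr.apply, hτ.2, hτ.1.mem]
  | add e f ihe ihf | sub e f ihe ihf =>
    simp only [usesBelow, Bool.and_eq_true] at h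
    refine comp_two h.2 (ihe h.1 hs.1 key) (fun τ hτ =>
      ihf (usesBelow_mono h.2 (by lia)) (safe_congr h.2 hτ hs.2) fun ρ v hρ =>
        ⟨fun r hr => by simp [Function.update_apply, hρ.reg r hr, hr.ne], hρ.mem, hρ.out⟩)
      fun τ h1 h2 h3 => Runs.instr ⟨key _ _ h1, ?_⟩
    simp [Instr.apply, h2, h3, eval]
  | mul e f ihe ihf =>
    simp only [usesBelow, Bool.and_eq_true] at h
    refine comp_two h.2 (ihe h.1 hs.1 key) (fun τ hτ =>
      ihf (usesBelow_mono h.2 (by lia)) (safe_congr h.2 hτ hs.2.1) fun ρ v hρ =>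
        ⟨fun r hr => by simp [Function.update_apply, hρ.reg r hr, hr.ne], hρ.mem, hρ.out⟩)
      fun τ h1 h2 h3 => (mulLoop_runs (by rw [h2]; exact hs.2.2)).seq fun ρ hρ =>
        Runs.instr ⟨key _ _ (h1.trans hρ.1), ?_⟩
    simp [Instr.apply, h2, h3, eval, hρ.2]
  | div e f ihe ihf | mod e f ihe ihf =>
    simp only [usesBelow, Bool.and_eq_true] at h
    refine comp_two h.2 (ihe h.1 hs.1 key) (fun τ hτ =>
      ihf (usesBelow_mono h.2 (by lia)) (safe_congr h.2 hτ hs.2.1) fun ρ v hρ =>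
        ⟨fun r hr => by simp [Function.update_apply, hρ.reg r hr, hr.ne], hρ.mem, hρ.out⟩)
      fun τ h1 h2 h3 => (divMod_runs (by rw [h2]; exact hs.2.2.1) (by rw [h3]; exact hs.2.2.2)).seq
        fun ρ hρ => Runs.instr ⟨key _ _ (h1.trans hρ.1), ?_⟩
    simp [Instr.apply, h2, h3, eval, hρ.2]

end Ex

/-! ### Statements -/

/-- Programs in which every loop runs over a range fixed when the loop is entered. -/
inductive Stmt where
  | skip
  | set (r : ℕ) (e : Ex)
  | store (a : ℕ) (e f : Ex)
  | write (e : Ex)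
  | seq (s s' : Stmt)
  | ite (e : Ex) (s s' : Stmt)
  | range (r : ℕ) (e : Ex) (s : Stmt)

infixr:40 ";;" => Stmt.seq

/-- Apply `f` with the register `r` running over `0, …, k - 1`. -/
def iter (f : State → State) (r : ℕ) : ℕ → State → State
  | 0, σ => σ
  | k + 1, σ => f ((iter f r k σ).setReg r k)

namespace Stmt

/-- The effect of a statement. -/
def sem : Stmt → State → State
  | skip, σ => σ
  | set r e, σ => σ.setReg r (e.eval σ)
  | store a e f, σ => σ.setMem a (e.eval σ) (f.eval σ)
  | write e, σ => σ.emit (e.eval σ)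
  | seq s s', σ => s'.sem (s.sem σ)
  | ite e s s', σ => if e.eval σ ≠ 0 then s.sem σ else s'.sem σ
  | range r e s, σ => iter s.sem r (e.eval σ) σ

/-- All ranges and other numbers that control the running time are at most `B`. -/
def Safe (B : ℕ) : Stmt → State → Prop
  | skip, _ => True
  | set _ e, σ => e.Safe B σ
  | store _ e f, σ => e.Safe B σ ∧ f.Safe B σ
  | write e, σ => e.Safe B σ
  | seq s s', σ => s.Safe B σ ∧ s'.Safe B (s.sem σ)
  | ite e s s', σ => e.Safe B σ ∧ if e.eval σ ≠ 0 then s.Safe B σ else s'.Safe B σ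
  | range r e s, σ => e.Safe B σ ∧ e.eval σ ≤ B ∧
      ∀ k < e.eval σ, s.Safe B ((iter s.sem r k σ).setReg r k)

/-- All registers used by the statement are below `d`. -/
def usesBelow (d : ℕ) : Stmt → Bool
  | skip => true
  | set r e => decide (r < d) && e.usesBelow d
  | store _ e f => e.usesBelow d && f.usesBelow d
  | write e => e.usesBelow d
  | seq s s' => s.usesBelow d && s'.usesBelow d
  | ite e s s' => e.usesBelow d && s.usesBelow d && s'.usesBelow d
  | range r e s => decide (r < d) && e.usesBelow d && s.usesBelow d

/-- Compilation, using the registers from `d` on as scratch space. -/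
def comp : Stmt → ℕ → Prog
  | skip, d => .instr (.const d 0)
  | set r e, d => .seq (e.comp d) <| .seq (.instr (.const (d + 1) 0)) (.instr (.add r d (d + 1)))
  | store a e f, d => .seq (e.comp d) <| .seq (f.comp (d + 1)) (.instr (.store a d (d + 1)))
  | write e, d => .seq (e.comp d) (.instr (.write d))
  | seq s s', d => .seq (s.comp d) (s'.comp d)
  | ite e s s', d => .seq (e.comp d) (.cond d (s.comp d) (s'.comp d))
  | range r e s, d => .seq (e.comp d) <| .seq (.instr (.const (d + 1) 0)) <|
      .seq (.instr (.sub (d + 2) d (d + 1))) <| .loop (d + 2) <|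
        .seq (.instr (.const (d + 2) 0)) <| .seq (.instr (.add r (d + 1) (d + 2))) <|
        .seq (s.comp (d + 2)) <| .seq (.instr (.const (d + 2) 1)) <|
        .seq (.instr (.add (d + 1) (d + 1) (d + 2))) (.instr (.sub (d + 2) d (d + 1)))

/-- A bound for the running time of the compiled statement. -/
def cost (B : ℕ) : Stmt → ℕ
  | skip => 1
  | set _ e => e.cost B + 2
  | store _ e f => e.cost B + (f.cost B + 1)
  | write e => e.cost B + 1
  | seq s s' => s.cost B + s'.cost B
  | ite e s s' => e.cost B + (s.cost B + s'.cost B + 1)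
  | range _ e s => e.cost B + (B * (s.cost B + 3 + 1 + 1 + 1) + 1 + 1 + 1)

theorem agree_iter {f : State → State} {d : ℕ} (hf : ∀ σ τ, Agree d σ τ → Agree d (f σ) (f τ))
    (r k : ℕ) {σ τ : State} (h : Agree d σ τ) : Agree d (iter f r k σ) (iter f r k τ) := by
  induction k with
  | zero => exact h
  | succ k ih => exact hf _ _ (ih.setReg r k)

/-- Compiled code leaves garbage in the scratch registers. This congruence allows the next statement
to start from the polluted state. -/
theorem sem_congr {s : Stmt} {d : ℕ} {σ τ : State} (h : s.usesBelow d) (hs : Agree d σ τ) :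
    Agree d (s.sem σ) (s.sem τ) := by
  induction s generalizing σ τ with
  | skip => exact hs
  | set r e =>
    simp only [usesBelow, Bool.and_eq_true] at h
    simp only [sem, Ex.eval_congr h.2 hs]
    exact hs.setReg _ _
  | store a e f =>
    simp only [usesBelow, Bool.and_eq_true] at h
    simp only [sem, Ex.eval_congr h.1 hs, Ex.eval_congr h.2 hs]
    exact ⟨hs.reg, by simp [setMem, hs.mem], hs.out⟩
  | write e =>
    simp only [sem, Ex.eval_congr h hs]
    exact ⟨hs.reg, hs.mem, by simp [hs.out]⟩
  | seq s s' ih ih' =>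
    simp only [usesBelow, Bool.and_eq_true] at h
    exact ih' h.2 (ih h.1 hs)
  | ite e s s' ih ih' =>
    simp only [usesBelow, Bool.and_eq_true] at h
    simp only [sem, Ex.eval_congr h.1.1 hs]
    split_ifs
    exacts [ih h.1.2 hs, ih' h.2 hs]
  | range r e s ih =>
    simp only [usesBelow, Bool.and_eq_true] at h
    simp only [sem, Ex.eval_congr h.1.2 hs]
    exact agree_iter (fun _ _ => ih h.2) _ _ hs

theorem safe_congr {s : Stmt} {d B : ℕ} {σ τ : State} (h : s.usesBelow d) (hs : Agree d σ τ)
    (hB : s.Safe B σ) : s.Safe B τ := by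
  induction s generalizing σ τ with
  | skip => trivial
  | set r e =>
    simp only [usesBelow, Bool.and_eq_true] at h
    exact Ex.safe_congr h.2 hs hB
  | store a e f =>
    simp only [usesBelow, Bool.and_eq_true] at h
    exact ⟨Ex.safe_congr h.1 hs hB.1, Ex.safe_congr h.2 hs hB.2⟩
  | write e => exact Ex.safe_congr h hs hB
  | seq s s' ih ih' =>
    simp only [usesBelow, Bool.and_eq_true] at h
    exact ⟨ih h.1 hs hB.1, ih' h.2 (sem_congr h.1 hs) hB.2⟩
  | ite e s s' ih ih' =>
    simp only [usesBelow, Bool.and_eq_true] at h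
    simp only [Safe, ← Ex.eval_congr h.1.1 hs] at hB ⊢
    refine ⟨Ex.safe_congr h.1.1 hs hB.1, ?_⟩
    have := hB.2
    split_ifs at this ⊢
    exacts [ih h.1.2 hs this, ih' h.2 hs this]
  | range r e s ih =>
    simp only [usesBelow, Bool.and_eq_true] at h
    simp only [Safe, ← Ex.eval_congr h.1.2 hs] at hB ⊢
    exact ⟨Ex.safe_congr h.1.2 hs hB.1, hB.2.1, fun k hk => ih h.2
      ((agree_iter (fun _ _ => sem_congr h.2) _ _ hs).setReg _ _) (hB.2.2 k hk)⟩

/-! ### What a statement leaves unchanged -/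

/-- The registers assigned by a statement. -/
def touches (r : ℕ) : Stmt → Bool
  | set r' _ => r == r'
  | seq s s' | ite _ s s' => s.touches r || s'.touches r
  | range r' _ s => r == r' || s.touches r
  | _ => false

/-- The arrays assigned by a statement. -/
def touchesMem (a : ℕ) : Stmt → Bool
  | store a' _ _ => a == a'
  | seq s s' | ite _ s s' => s.touchesMem a || s'.touchesMem a
  | range _ _ s => s.touchesMem a
  | _ => false

/-- The statement may write output. -/
def writes : Stmt → Bool
  | write _ => true
  | seq s s' | ite _ s s' => s.writes || s'.writes
  | range _ _ s => s.writes
  | _ => false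

/-- The hypothesis is a Boolean computed from the syntax, so for concrete statements it is usually
discharged by `rfl`. -/
theorem sem_reg {s : Stmt} {r : ℕ} (σ : State) (h : s.touches r = false) :
    (s.sem σ).reg r = σ.reg r := by
  induction s generalizing σ with
  | skip | store | write => rfl
  | set r' e => simp_all [touches, sem]
  | seq s s' ih ih' => simp_all [touches, sem]
  | ite e s s' ih ih' => simp_all [touches, sem]; split_ifs <;> simp_all
  | range r' e s ih =>
    simp only [touches, Bool.or_eq_false_iff, beq_eq_false_iff_ne] at h
    simp only [sem]
    generalize e.eval σ = k
    induction k with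
    | zero => rfl
    | succ k ihk => simp [iter, ih _ h.2, h.1, ihk]

theorem sem_mem {s : Stmt} {a : ℕ} (σ : State) (h : s.touchesMem a = false) :
    (s.sem σ).mem a = σ.mem a := by
  induction s generalizing σ with
  | skip | set | write => rfl
  | store a' e f => simp_all [touchesMem, sem]
  | seq s s' ih ih' => simp_all [touchesMem, sem]
  | ite e s s' ih ih' => simp_all [touchesMem, sem]; split_ifs <;> simp_all
  | range r' e s ih =>
    simp only [sem]
    generalize e.eval σ = k
    induction k with
    | zero => rfl
    | succ k ihk => simp [iter, ih _ h, ihk]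

theorem sem_out {s : Stmt} (σ : State) (h : s.writes = false) : (s.sem σ).out = σ.out := by
  induction s generalizing σ with
  | skip | set | store => rfl
  | write => simp [writes] at h
  | seq s s' ih ih' => simp_all [writes, sem]
  | ite e s s' ih ih' => simp_all [writes, sem]; split_ifs <;> simp_all
  | range r' e s ih =>
    simp only [sem]
    generalize e.eval σ = k
    induction k with
    | zero => rfl
    | succ k ihk => simp [iter, ih _ h, ihk]

/-- Protects the limit and the counter of a compiled loop, which sit in registers `d` and `d + 1`,
from the loop body. -/
theorem touches_of_usesBelow {s : Stmt} {d r : ℕ} (h : s.usesBelow d) (hr : d ≤ r) :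
    s.touches r = false := by
  induction s <;> simp_all [usesBelow, touches] <;> lia

/-! ### Correctness of the compiler -/

/-- The time bound depends only on `s` and `B`. All later work can therefore reason about `sem` and
`Safe` and forget the machine. -/
theorem comp_runs {s : Stmt} {B d : ℕ} {σ : State} (h : s.usesBelow d) (hs : s.Safe B σ) :
    Runs (s.comp d) σ (s.cost B) fun τ => Agree d (s.sem σ) τ := by
  induction s generalizing d σ with
  | skip =>
    exact Runs.instr ((Agree.refl d σ).setReg_right (le_refl d) 0)
  | set r e =>
    simp only [usesBelow, Bool.and_eq_true, decide_eq_true_eq] at h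
    refine (Ex.comp_runs h.2 hs).seq fun τ hτ => Runs.instr_seq (Runs.instr ?_)
    refine ⟨fun r' hr => ?_, hτ.1.mem, hτ.1.out⟩
    simp [Instr.apply, sem, Function.update_apply, hτ.2, hτ.1.reg r' hr, (show r' ≠ d + 1 by lia)]
  | store a e f =>
    simp only [usesBelow, Bool.and_eq_true] at h
    refine Ex.comp_two h.2 (Ex.comp_runs h.1 hs.1) (fun τ hτ => Ex.comp_runs
      (Ex.usesBelow_mono h.2 (by lia)) (Ex.safe_congr h.2 hτ hs.2)) fun τ h1 h2 h3 => Runs.instr ?_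
    refine ⟨h1.reg, ?_, h1.out⟩
    simp [Instr.apply, sem, setMem, h2, h3, h1.mem]
  | write e =>
    refine (Ex.comp_runs h hs).seq fun τ hτ => Runs.instr ⟨hτ.1.reg, hτ.1.mem, ?_⟩
    simp [Instr.apply, sem, hτ.2, hτ.1.out]
  | seq s s' ih ih' =>
    simp only [usesBelow, Bool.and_eq_true] at h
    exact (ih h.1 hs.1).seq fun τ hτ => (ih' h.2 (safe_congr h.2 hτ hs.2)).mono le_rfl
      fun ρ hρ => (sem_congr h.2 hτ).trans hρ
  | ite e s s' ih ih' =>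
    simp only [usesBelow, Bool.and_eq_true] at h
    refine (Ex.comp_runs h.1.1 hs.1).seq fun τ hτ => ?_
    have h2 := hs.2
    simp only [sem]
    split_ifs at h2 ⊢ with hc
    · obtain ⟨ρ, t, he, ht, hρ⟩ := ih h.1.2 (safe_congr h.1.2 hτ.1 h2)
      exact ⟨ρ, _, .cond_true (by rwa [hτ.2]) he, by lia, (sem_congr h.1.2 hτ.1).trans hρ⟩
    · obtain ⟨ρ, t, he, ht, hρ⟩ := ih' h.2 (safe_congr h.2 hτ.1 h2)
      exact ⟨ρ, _, .cond_false (by simpa [hτ.2] using hc) he, by lia, (sem_congr h.2 hτ.1).trans hρ⟩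
  | range r e s ih =>
    simp only [usesBelow, Bool.and_eq_true, decide_eq_true_eq] at h
    obtain ⟨hs1, hs2, hs3⟩ := hs
    refine (Ex.comp_runs h.1.2 hs1).seq fun τ hτ => Runs.instr_seq (Runs.instr_seq ?_)
    set K := e.eval σ with hK
    -- Here `j` is the number of rounds left. Registers `d`, `d + 1`, `d + 2` hold the limit, the
    -- rounds done and the rounds left; the last is scratch for the body and is recomputed after it.
    refine (Runs.loop (T := s.cost B + 3 + 1 + 1) (fun j τ => j ≤ K ∧ τ.reg d = K ∧
      τ.reg (d + 1) = K - j ∧ τ.reg (d + 2) = j ∧ Agree d (iter s.sem r (K - j) σ) τ) K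
      (fun j τ h => by rw [h.2.2.2.1]) ?_ ?_).mono (by gcongr) ?_
    · rintro j τ hj ⟨-, h2, h3, h4, h5⟩
      refine Runs.instr_seq (Runs.instr_seq ?_)
      generalize hτ' : Instr.apply (.add r (d + 1) (d + 2)) _ = τ'
      have hd : τ'.reg d = K ∧ τ'.reg (d + 1) = K - (j + 1) := by
        subst hτ'
        simp [Instr.apply, Function.update_apply, h2, h3, (show d ≠ r by lia),
          (show d + 1 ≠ r by lia)]
      have hA : Agree d ((iter s.sem r (K - (j + 1)) σ).setReg r (K - (j + 1))) τ' := by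
        subst hτ'
        refine ⟨fun r' hr => ?_, h5.mem, h5.out⟩
        simp [Instr.apply, Function.update_apply, h3, (show r' ≠ d + 2 by lia), h5.reg r' hr]
      have hs' := safe_congr h.2 hA (hs3 (K - (j + 1)) (by lia))
      have hb : s.usesBelow (d + 2) := by
        clear * - h
        have := h.2
        clear h
        induction s <;> simp_all [usesBelow] <;>
          first | lia | grind [Ex.usesBelow_mono]
      refine ((ih hb hs').seq (T' := 3) fun ρ hρ =>
        Runs.instr_seq (Runs.instr_seq (Runs.instr ?_))).mono (by lia) (fun _ => id)
      have e1 : ρ.reg d = K := by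
        rw [← hρ.reg d (by lia), sem_reg _ (touches_of_usesBelow h.2 le_rfl), hd.1]
      have e2 : ρ.reg (d + 1) = K - (j + 1) := by
        rw [← hρ.reg (d + 1) (by lia), sem_reg _ (touches_of_usesBelow h.2 (by lia)), hd.2]
      refine ⟨by lia, ?_, ?_, ?_, ?_⟩
      · simp [Instr.apply, Function.update_apply, e1]
      · simp [Instr.apply, Function.update_apply, e2]; lia
      · simp [Instr.apply, Function.update_apply, e1, e2]; lia
      · rw [show K - j = (K - (j + 1)) + 1 by lia]
        refine ((sem_congr h.2 hA).trans (hρ.mono (by lia))).trans ⟨fun r' hr => ?_, rfl, rfl⟩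
        simp [Instr.apply, Function.update_apply, (show r' ≠ d + 2 by lia),
          (show r' ≠ d + 1 by lia)]
    · refine ⟨le_rfl, ?_, ?_, ?_, ?_⟩
      · simp [Instr.apply, Function.update_apply, hτ.2]
      · simp [Instr.apply, Function.update_apply]
      · simp [Instr.apply, Function.update_apply, hτ.2]
      · refine Agree.trans (τ := τ) (by simpa [iter] using hτ.1) ⟨fun r' hr => ?_, rfl, rfl⟩
        simp [Instr.apply, Function.update_apply, (show r' ≠ d + 2 by lia),
          (show r' ≠ d + 1 by lia)]
    · rintro τ ⟨-, -, -, -, h5⟩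
      rw [Nat.sub_zero] at h5
      exact h5

end Stmt

/-! ### Polynomial bounds -/

/-- The function `f` is given by a polynomial. -/
def PolyFun (f : ℕ → ℕ) : Prop := ∃ p : Polynomial ℕ, ∀ N, f N = p.eval N

theorem PolyFun.const (c : ℕ) : PolyFun fun _ => c := ⟨.C c, by simp⟩
theorem PolyFun.id : PolyFun fun N => N := ⟨.X, by simp⟩
theorem PolyFun.add {f g : ℕ → ℕ} : PolyFun f → PolyFun g → PolyFun fun N => f N + g N := by
  rintro ⟨p, hp⟩ ⟨q, hq⟩
  exact ⟨p + q, by simp [hp, hq]⟩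
theorem PolyFun.mul {f g : ℕ → ℕ} : PolyFun f → PolyFun g → PolyFun fun N => f N * g N := by
  rintro ⟨p, hp⟩ ⟨q, hq⟩
  exact ⟨p * q, by simp [hp, hq]⟩
theorem PolyFun.comp {f g : ℕ → ℕ} : PolyFun f → PolyFun g → PolyFun fun N => f (g N) := by
  rintro ⟨p, hp⟩ ⟨q, hq⟩
  exact ⟨p.comp q, by simp [hp, hq]⟩

theorem Ex.polyFun_cost (e : Ex) : PolyFun fun B => e.cost B := by
  induction e <;> simp only [Ex.cost] <;>
    repeat first | assumption | exact .const _ | exact .id | apply PolyFun.add | apply PolyFun.mul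

/-- For a fixed program the cost is built from constants and `B` by sums and products; each nested
loop contributes one more factor `B`. -/
theorem Stmt.polyFun_cost (s : Stmt) : PolyFun fun B => s.cost B := by
  induction s <;> simp only [Stmt.cost] <;>
    repeat first | assumption | exact Ex.polyFun_cost _ | exact .const _ | exact .id |
      apply PolyFun.add | apply PolyFun.mul

/-! ### Verification rules -/

/-- Everything that the statement `s` does not assign is the same in `σ` and `τ`. -/
structure Frame (s : Stmt) (σ τ : State) : Prop where
  reg : ∀ r, s.touches r = false → τ.reg r = σ.reg r
  mem : ∀ a, s.touchesMem a = false → τ.mem a = σ.mem a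
  out : s.writes = false → τ.out = σ.out

theorem Frame.sem (s : Stmt) (σ : State) : Frame s σ (s.sem σ) :=
  ⟨fun _ => s.sem_reg σ, fun _ => s.sem_mem σ, s.sem_out σ⟩

/-- Started in `σ`, the statement `s` is safe and ends in a configuration satisfying `Q`. -/
def Spec (B : ℕ) (s : Stmt) (σ : State) (Q : State → Prop) : Prop := s.Safe B σ ∧ Q (s.sem σ)

namespace Spec

variable {B r a : ℕ} {e f : Ex} {s s' : Stmt} {σ : State} {Q R : State → Prop}

theorem mono (h : Spec B s σ Q) (hQ : ∀ τ, Q τ → R τ) : Spec B s σ R := ⟨h.1, hQ _ h.2⟩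

/-- The frame is supplied automatically, so `R` only has to mention what the first statement
changes. -/
theorem seq (h : Spec B s σ R) (h' : ∀ τ, Frame s σ τ → R τ → Spec B s' τ Q) :
    Spec B (s ;; s') σ Q :=
  ⟨⟨h.1, (h' _ (.sem s σ) h.2).1⟩, (h' _ (.sem s σ) h.2).2⟩

@[simp] theorem skip_iff : Spec B .skip σ Q ↔ Q σ := by simp [Spec, Stmt.Safe, Stmt.sem]

@[simp] theorem set_iff : Spec B (.set r e) σ Q ↔ e.Safe B σ ∧ Q (σ.setReg r (e.eval σ)) := Iff.rfl

@[simp] theorem store_iff :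
    Spec B (.store a e f) σ Q ↔ (e.Safe B σ ∧ f.Safe B σ) ∧ Q (σ.setMem a (e.eval σ) (f.eval σ)) :=
  Iff.rfl

@[simp] theorem write_iff : Spec B (.write e) σ Q ↔ e.Safe B σ ∧ Q (σ.emit (e.eval σ)) := Iff.rfl

theorem seq_iff : Spec B (s ;; s') σ Q ↔ Spec B s σ fun τ => Spec B s' τ Q := by
  simp [Spec, Stmt.Safe, Stmt.sem, and_assoc]

@[simp] theorem set_seq_iff : Spec B (.set r e ;; s) σ Q ↔
    e.Safe B σ ∧ Spec B s (σ.setReg r (e.eval σ)) Q := by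
  rw [seq_iff, set_iff]

@[simp] theorem store_seq_iff : Spec B (.store a e f ;; s) σ Q ↔
    (e.Safe B σ ∧ f.Safe B σ) ∧ Spec B s (σ.setMem a (e.eval σ) (f.eval σ)) Q := by
  rw [seq_iff, store_iff]

@[simp] theorem write_seq_iff : Spec B (.write e ;; s) σ Q ↔
    e.Safe B σ ∧ Spec B s (σ.emit (e.eval σ)) Q := by
  rw [seq_iff, write_iff]

theorem ite_iff : Spec B (.ite e s s') σ Q ↔
    e.Safe B σ ∧ (e.eval σ ≠ 0 → Spec B s σ Q) ∧ (e.eval σ = 0 → Spec B s' σ Q) := by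
  by_cases h : e.eval σ = 0 <;> simp [Spec, Stmt.Safe, Stmt.sem, h, and_assoc]

theorem range (I : ℕ → State → Prop) (K : ℕ) (he : e.Safe B σ) (hK : e.eval σ = K)
    (hB : K ≤ B) (h0 : I 0 σ)
    (hstep : ∀ k < K, ∀ τ, Frame (.range r e s) σ τ → I k τ →
      Spec B s (τ.setReg r k) (I (k + 1)))
    (hQ : ∀ τ, Frame (.range r e s) σ τ → I K τ → Q τ) : Spec B (.range r e s) σ Q := by
  subst hK
  -- The state after `k` rounds is the result of the loop with literal limit `k`, and that loop
  -- assigns the same registers and arrays.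
  have hf : ∀ k, Frame (.range r e s) σ (iter s.sem r k σ) := fun k =>
    have := Frame.sem (.range r (.lit k) s) σ
    ⟨this.reg, this.mem, this.out⟩
  have key : ∀ k ≤ e.eval σ, I k (iter s.sem r k σ) := by
    intro k hk
    induction k with
    | zero => exact h0
    | succ k ih => exact (hstep k hk _ (hf k) (ih (by lia))).2
  exact ⟨⟨he, hB, fun k hk => (hstep k hk _ (hf k) (key k hk.le)).1⟩, hQ _ (hf _) (key _ le_rfl)⟩

theorem frame (h : Spec B s σ Q) : Spec B s σ fun τ => Q τ ∧ Frame s σ τ :=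
  ⟨h.1, h.2, .sem s σ⟩

end Spec

end RAM

/-! ### Gate sequences, generated pairs and the layout of the input -/

namespace FinAlgebra

variable {A : FinAlgebra}

/-! ### Sequences of gates -/

variable (A) in
/-- A gate: an operation symbol and the numbers of the in-neighbours. -/
abbrev Gate : Type := Σ i : Fin A.numOps, (Fin (A.arity i) → ℕ)

/-- The values of the vertices after evaluating the first `G` gates on the input `x`. Vertices
`0, 1, 2` are the inputs, and gate `g` is vertex `3 + g`. -/
def vals (gate : ℕ → A.Gate) (x : Fin 3 → Fin A.card) : ℕ → ℕ → Fin A.card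
  -- `x 0` is a junk value for vertices without a gate; in an `Ordered` sequence no gate reads it.
  | 0 => fun v => if h : v < 3 then x ⟨v, h⟩ else x 0
  | G + 1 => Function.update (vals gate x G) (3 + G)
      (A.op (gate G).1 fun j => vals gate x G ((gate G).2 j))

/-- Every in-neighbour is an input or an earlier gate. -/
def Ordered (gate : ℕ → A.Gate) (G : ℕ) : Prop := ∀ g < G, ∀ j, (gate g).2 j < 3 + g

/-- The position of gate `g` in the list describing the circuit. -/
def pos (gate : ℕ → A.Gate) : ℕ → ℕ
  | 0 => 0
  | g + 1 => pos gate g + (1 + A.arity (gate g).1)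

section Gates

variable {gate gate' : ℕ → A.Gate} {G G' v : ℕ} {x : Fin 3 → Fin A.card}

theorem vals_congr (h : ∀ g < G, gate g = gate' g) : vals gate x G = vals gate' x G := by
  induction G with
  | zero => rfl
  | succ G ih =>
    simp only [vals, ih fun g hg => h g (by lia)]
    rw [h G (by lia)]

theorem vals_of_le (hG : G ≤ G') (hv : v < 3 + G) : vals gate x G' v = vals gate x G v := by
  induction G', hG using Nat.le_induction with
  | base => rfl
  | succ G' h ih => rw [vals, Function.update_of_ne (by lia), ih]

/-- The circuit only grows, so everything known about recorded vertices persists through later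
rounds. -/
theorem vals_extend (hG : G ≤ G') (h : ∀ g < G, gate' g = gate g) (hv : v < 3 + G) :
    vals gate' x G' v = vals gate x G v := by
  rw [vals_of_le hG hv, vals_congr h]

theorem vals_gate (ho : Ordered gate G) {g : ℕ} (hg : g < G) :
    vals gate x G (3 + g) = A.op (gate g).1 fun j => vals gate x G ((gate g).2 j) := by
  rw [vals_of_le (G := g + 1) (by lia) (by lia), vals, Function.update_self]
  congr 1
  funext j
  rw [vals_of_le hg.le (ho g hg j)]

theorem pos_congr (h : ∀ g < G, gate g = gate' g) : pos gate G = pos gate' G := by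
  induction G with
  | zero => rfl
  | succ G ih => simp only [pos, ih fun g hg => h g (by lia), h G (by lia)]

theorem pos_mono (gate : ℕ → A.Gate) : Monotone (pos gate) :=
  monotone_nat_of_le_succ fun g => by simp [pos]

theorem pos_le {N : ℕ} (h : ∀ i, A.arity i ≤ N) (gate : ℕ → A.Gate) (G : ℕ) :
    pos gate G ≤ G * (N + 1) := by
  induction G with
  | zero => simp [pos]
  | succ G ih =>
    have := h (gate G).1
    rw [pos, Nat.succ_mul]
    lia

/-- A property of vertices that holds for the inputs and passes to gates. -/
theorem vertex_induction (ho : Ordered gate G) {p : ℕ → Prop} (h0 : ∀ v < 3, p v)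
    (hg : ∀ g < G, (∀ j, p ((gate g).2 j)) → p (3 + g)) : ∀ v < 3 + G, p v := by
  intro v
  induction v using Nat.strong_induction_on with
  | _ v ih =>
    intro hv
    by_cases h3 : v < 3
    · exact h0 v h3
    · obtain ⟨g, rfl⟩ : ∃ g, v = 3 + g := ⟨v - 3, by lia⟩
      exact hg g (by lia) fun j => ih _ (ho g (by lia) j)
        ((ho g (by lia) j).trans (by lia))

theorem vals_input (hv : v < 3) : vals gate x G v = x ⟨v, hv⟩ := by
  rw [vals_of_le (Nat.zero_le G) (by lia)]
  exact dif_pos hv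

theorem vals_const (hA : A.IsIdempotent) (ho : Ordered gate G) (a : Fin A.card)
    (hv : v < 3 + G) : vals gate (fun _ => a) G v = a := by
  revert hv v
  show ∀ v < 3 + G, _
  refine vertex_induction ho (fun v hv => vals_input hv) fun g hg ih => ?_
  simp only [vals_gate ho hg, ih, hA (gate g).1 a]

/-- The circuit unfolds into a tree. The term may be exponentially large, but only its existence
matters. -/
theorem vals_isTermOp (ho : Ordered gate G) (hv : v < 3 + G) :
    A.IsTermOp fun x => vals gate x G v := by
  revert hv v
  show ∀ v < 3 + G, _
  refine vertex_induction ho (fun v hv => ⟨.var ⟨v, hv⟩, fun x => (vals_input hv).symm⟩)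
    fun g hg ih => ?_
  choose t ht using ih
  refine ⟨.func (⟨(gate g).1, rfl⟩ : A.lang.Functions (A.arity (gate g).1)) t, fun x => ?_⟩
  refine Eq.trans ?_ (vals_gate ho hg).symm
  exact congrArg (A.op (gate g).1) (funext fun j => ht j x)

/-! ### The circuit given by a sequence of gates -/

/-- The vertex with a given number. -/
def vertex (G v : ℕ) (hv : v < 3 + G) : Fin 3 ⊕ Fin G :=
  if h : v < 3 then .inl ⟨v, h⟩ else .inr ⟨v - 3, by lia⟩

/-- The number of a vertex. -/
def vertexNum : Fin 3 ⊕ Fin G → ℕ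
  | .inl i => i
  | .inr g => 3 + g

theorem vertexNum_vertex (hv : v < 3 + G) : vertexNum (vertex G v hv) = v := by
  unfold vertex
  split_ifs with h
  · rfl
  · simp only [vertexNum]; lia

theorem vertex_gate {g : ℕ} (hg : g < G) :
    vertex G (3 + g) (by lia) = Sum.inr ⟨g, hg⟩ := by
  rw [vertex, dif_neg (by lia)]
  simp

/-- The circuit with a given sequence of gates and a given output vertex. -/
def toCircuit (gate : ℕ → A.Gate) (ho : Ordered gate G) (hv : v < 3 + G) : A.Circuit 3 where
  numGates := G
  label g := (gate g).1
  inNbr g j := vertex G ((gate g).2 j) ((ho g g.2 j).trans (by lia))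
  output := vertex G v hv
  acyclic u hu := by
    have key : ∀ u w, Relation.TransGen (fun u w => ∃ g : Fin G, w = Sum.inr g ∧
        ∃ j, vertex G ((gate g).2 j) ((ho g g.2 j).trans (by lia)) = u) u w →
        vertexNum u < vertexNum w := by
      have single : ∀ (g : Fin G) j, vertexNum (vertex G ((gate g).2 j)
          ((ho g g.2 j).trans (by lia))) < vertexNum (Sum.inr g : Fin 3 ⊕ Fin G) := fun g j => by
        rw [vertexNum_vertex]
        exact ho g g.2 j
      intro u w h
      induction h with
      | single h =>
        obtain ⟨g, rfl, j, rfl⟩ := h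
        exact single g j
      | tail _ h ih =>
        obtain ⟨g, rfl, j, rfl⟩ := h
        exact ih.trans (single g j)
    exact lt_irrefl _ (key u u hu)

theorem toCircuit_value (ho : Ordered gate G) (hv : v < 3 + G) (w : ℕ) (hw : w < 3 + G) :
    (toCircuit gate ho hv).value x (vertex G w hw) = vals gate x G w := by
  suffices ∀ w < 3 + G, ∀ hw : w < 3 + G,
      (toCircuit gate ho hv).value x (vertex G w hw) = vals gate x G w from this w hw hw
  refine vertex_induction ho (fun v hv hw => ?_) fun g hg ih hw => ?_
  · rw [vals_input hv, vertex, dif_pos hv]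
    exact Circuit.value_input _ _ _
  · rw [vals_gate ho hg, vertex_gate hg]
    refine (Circuit.value_gate _ _ _).trans (congrArg (A.op _) (funext fun j => ?_))
    exact ih j ((ho g hg j).trans (by lia))

theorem toCircuit_fn (ho : Ordered gate G) (hv : v < 3 + G) :
    (toCircuit gate ho hv).fn = fun x => vals gate x G v := by
  funext x
  exact toCircuit_value ho hv v hv

theorem vertexCode_vertex (ho : Ordered gate G) (hv : v < 3 + G) {w : ℕ} (hw : w < 3 + G) :
    (toCircuit gate ho hv).vertexCode (vertex G w hw) = w := by
  conv_rhs => rw [← vertexNum_vertex hw]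
  generalize vertex G w hw = u
  cases u <;> rfl

/-- The numbers describing a gate. -/
def gateCode (g : A.Gate) : List ℕ := (g.1 : ℕ) :: List.ofFn g.2

theorem toCircuit_code (ho : Ordered gate G) (hv : v < 3 + G) :
    (toCircuit gate ho hv).code =
      G :: ((List.range G).flatMap (fun g => gateCode (gate g)) ++ [v]) := by
  have h : (toCircuit gate ho hv).code = G :: ((List.finRange G).flatMap
      (fun g : Fin G => gateCode (gate g)) ++ [v]) := by
    unfold Circuit.code
    rw [show (toCircuit gate ho hv).vertexCode (toCircuit gate ho hv).output = v from
      vertexCode_vertex ho hv hv]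
    have h2 : ∀ g : Fin G, (List.ofFn fun j => (toCircuit gate ho hv).vertexCode
        ((toCircuit gate ho hv).inNbr g j)) = List.ofFn (gate g).2 := fun g =>
      congrArg List.ofFn (funext fun j => vertexCode_vertex ho hv ((ho g g.2 j).trans (by lia)))
    congr 3
    funext g
    exact congrArg _ (h2 g)
  rw [h, ← List.map_coe_finRange_eq_range, List.flatMap_map]

end Gates

/-! ### Closure of three pairs under the operations -/

/-- The pairs generated from `S` by at most `p` rounds of applying operations. -/
def stage (A : FinAlgebra) (S : Set (Fin A.card × Fin A.card)) : ℕ → Set (Fin A.card × Fin A.card)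
  | 0 => S
  | p + 1 => stage A S p ∪ {y | ∃ (i : Fin A.numOps) (α β : Fin (A.arity i) → Fin A.card),
      (∀ j, (α j, β j) ∈ stage A S p) ∧ y = (A.op i α, A.op i β)}

variable {S : Set (Fin A.card × Fin A.card)}

/-- An increasing chain of subsets of an n²-element set that stays constant once two consecutive
members agree has stopped after n² steps. -/
theorem stage_stable :
    stage A S (A.card * A.card) = stage A S (A.card * A.card + 1) := by
  have hm : Monotone (stage A S) := monotone_nat_of_le_succ fun p => Set.subset_union_left
  have hs : ∀ m, (stage A S m).ncard = (stage A S (m + 1)).ncard →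
      stage A S m = stage A S (m + 1) := fun m h =>
    Set.eq_of_subset_of_ncard_le (hm (Nat.le_succ m)) h.ge (Set.toFinite _)
  have hb : ∀ m, (stage A S m).ncard ≤ A.card * A.card := fun m => by
    refine (Set.ncard_le_card _).trans ?_
    simp
  have hmono : Monotone fun m => (stage A S m).ncard :=
    fun m m' h => Set.ncard_le_ncard (hm h) (Set.toFinite _)
  have hstab : ∀ m, (stage A S m).ncard = (stage A S (m + 1)).ncard →
      (stage A S (m + 1)).ncard = (stage A S (m + 2)).ncard := fun m h => by
    have h' := hs m h
    have h'' : stage A S (m + 1) = stage A S (m + 2) := by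
      change _ ∪ _ = stage A S (m + 1) ∪ _
      rw [← h']
    rw [h'']
  refine hs _ ?_
  rw [Nat.stabilises_of_monotone hmono hb hstab (Nat.le_succ _)]

/-- The full closure contains the values of every term operation. -/
theorem mem_stage_of_isTermOp {m : ℕ} {f : (Fin m → Fin A.card) → Fin A.card}
    (hf : A.IsTermOp f) {α β : Fin m → Fin A.card} (h : ∀ j, (α j, β j) ∈ S) :
    (f α, f β) ∈ stage A S (A.card * A.card) := by
  obtain ⟨t, ht⟩ := hf
  rw [← ht, ← ht]
  clear ht f
  induction t with
  | var j =>
    have hm : Monotone (stage A S) := monotone_nat_of_le_succ fun p => Set.subset_union_left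
    exact hm (Nat.zero_le _) (h j)
  | func s ts ih =>
    obtain ⟨i, rfl⟩ := s
    rw [stage_stable]
    exact Or.inr ⟨i, fun j => (ts j).realize α, fun j => (ts j).realize β, ih, rfl⟩

/-! ### The input -/

variable (A) in
/-- The number of entries of the `i`-th table. -/
def tableSize (i : ℕ) : ℕ := if h : i < A.numOps then A.card ^ A.arity ⟨i, h⟩ else 0

theorem tableSize_fin (i : Fin A.numOps) : A.tableSize i = A.card ^ A.arity i := dif_pos i.2

variable (A) in
/-- The position of the `i`-th table in the input. -/
def tablePos (i : ℕ) : ℕ := 2 + A.numOps + ∑ j ∈ Finset.range i, A.tableSize j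

theorem getD_flatMap_range (f : ℕ → List ℕ) {k i e : ℕ} (hi : i < k) (he : e < (f i).length) :
    ((List.range k).flatMap f).getD (∑ j ∈ Finset.range i, (f j).length + e) 0 =
      (f i).getD e 0 := by
  have hlen : ∀ k, ((List.range k).flatMap f).length = ∑ j ∈ Finset.range k, (f j).length := by
    intro k
    induction k with
    | zero => simp
    | succ k ih => simp [List.range_succ, ih, Finset.sum_range_succ]
  induction k with
  | zero => simp at hi
  | succ k ih =>
    rw [List.range_succ, List.flatMap_append]
    rcases Nat.lt_succ_iff_lt_or_eq.1 hi with h | rfl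
    · rw [List.getD_append, ih h]
      rw [hlen]
      calc _ < ∑ j ∈ Finset.range (i + 1), (f j).length := by rw [Finset.sum_range_succ]; lia
        _ ≤ _ := Finset.sum_le_sum_of_subset (by simpa using h)
    · rw [List.getD_append_right _ _ _ _ (by rw [hlen]; lia), hlen]
      simp

theorem code_getD_zero : A.code.getD 0 0 = A.card := rfl

theorem code_getD_one : A.code.getD 1 0 = A.numOps := rfl

theorem code_getD_arity (i : Fin A.numOps) : A.code.getD (2 + i) 0 = A.arity i := by
  rw [code, show 2 + (i : ℕ) = i + 1 + 1 by lia, List.getD_cons_succ, List.getD_cons_succ,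
    List.getD_append _ _ _ _ (by simp)]
  simp

theorem code_getD_table (i : Fin A.numOps) (e : Fin (A.card ^ A.arity i)) :
    A.code.getD (A.tablePos i + e) 0 = A.op i (finFunctionFinEquiv.symm e) := by
  set f : ℕ → List ℕ := fun j => if h : j < A.numOps then A.table ⟨j, h⟩ else [] with hf
  have hfi : ∀ i : Fin A.numOps, f i = A.table i := fun i => dif_pos i.2
  have h1 : (List.finRange A.numOps).flatMap A.table = (List.range A.numOps).flatMap f := by
    rw [← List.map_coe_finRange_eq_range, List.flatMap_map]
    exact congrArg (List.flatMap · _) (funext fun i => (hfi i).symm)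
  have h2 : ∀ j, (f j).length = A.tableSize j := fun j => by
    simp only [hf, tableSize]
    split_ifs <;> simp [table]
  rw [code, tablePos, show ∀ s : ℕ, 2 + A.numOps + s + e = A.numOps + (s + e) + 1 + 1 by lia,
    List.getD_cons_succ, List.getD_cons_succ, List.getD_append_right _ _ _ _ (by simp), h1]
  simp only [List.length_ofFn, Nat.add_sub_cancel_left, ← h2]
  rw [getD_flatMap_range f i.2 (by rw [h2, tableSize_fin]; exact e.2), hfi, table]
  simp

theorem tableSize_le_size (i : Fin A.numOps) : A.card ^ A.arity i ≤ A.size :=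
  Finset.single_le_sum (f := fun i => A.card ^ A.arity i) (fun _ _ => Nat.zero_le _)
    (Finset.mem_univ i)

theorem numOps_le_size (h : 2 ≤ A.card) : A.numOps ≤ A.size := by
  calc A.numOps = ∑ _ : Fin A.numOps, 1 := by simp
    _ ≤ _ := Finset.sum_le_sum fun i _ => Nat.one_le_pow _ _ (by lia)

/-- From m < n^m. This fails for one element, where a table has a single entry whatever the arity;
the program therefore treats trivial algebras separately. -/
theorem arity_le_size (h : 2 ≤ A.card) (i : Fin A.numOps) : A.arity i ≤ A.size :=
  (Nat.lt_pow_self h).le.trans (tableSize_le_size i)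

theorem card_le_size (h0 : 0 < A.numOps) (ha : ∀ i, 0 < A.arity i) : A.card ≤ A.size :=
  (Nat.le_self_pow (ha ⟨0, h0⟩).ne' _).trans (tableSize_le_size ⟨0, h0⟩)

end FinAlgebra

open RAM FinAlgebra

/-! ### The correction algorithm and its verification -/

namespace MaltsevSearch

/-! ### The program -/

notation "ν" => RAM.Ex.var
notation "rCard" => (0 : ℕ)
notation "rOps" => (1 : ℕ)
notation "rA" => (2 : ℕ)
notation "rB" => (3 : ℕ)
notation "rC" => (4 : ℕ)
notation "rD" => (5 : ℕ)
notation "rT" => (6 : ℕ)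
notation "rTR" => (7 : ℕ)
notation "rQ" => (8 : ℕ)
notation "rQ1" => (9 : ℕ)
notation "rQ2" => (10 : ℕ)
notation "rGates" => (11 : ℕ)
notation "rLen" => (12 : ℕ)
notation "rFail" => (13 : ℕ)
notation "rOp" => (14 : ℕ)
notation "rArity" => (15 : ℕ)
notation "rTable" => (16 : ℕ)
notation "rOffset" => (17 : ℕ)
notation "rE1" => (18 : ℕ)
notation "rE2" => (19 : ℕ)
notation "rJ" => (20 : ℕ)
notation "rPass" => (21 : ℕ)
notation "rOk" => (22 : ℕ)
notation "rKey" => (23 : ℕ)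
notation "rGate" => (24 : ℕ)
notation "rPos" => (25 : ℕ)
notation "rIdx" => (26 : ℕ)
notation "rPow" => (27 : ℕ)
notation "rX" => (28 : ℕ)
notation "rY" => (29 : ℕ)
notation "rLeft" => (30 : ℕ)
notation "rRight" => (31 : ℕ)
notation "mInput" => (0 : ℕ)
notation "mOffset" => (1 : ℕ)
notation "mTable" => (2 : ℕ)
notation "mDesc" => (3 : ℕ)
notation "mVal1" => (4 : ℕ)
notation "mVal2" => (5 : ℕ)
notation "mFound" => (6 : ℕ)
notation "mFst" => (7 : ℕ)
notation "mSnd" => (8 : ℕ)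
notation "mThd" => (9 : ℕ)
notation "mKey" => (10 : ℕ)

/-- Tabulate the positions and the sizes of the operation tables. -/
def prelude : Stmt :=
  .set rPos (2 + ν rOps) ;;
  .range rOp (ν rOps) (
    .set rPow 1 ;;
    .range rJ (.load mInput (2 + ν rOp)) (.set rPow (ν rCard * ν rPow)) ;;
    .store mOffset (ν rOp) (ν rPos) ;;
    .store mTable (ν rOp) (ν rPow) ;;
    .set rPos (ν rPos + ν rPow))

/-- Evaluate the gate described from position `rPos` on. -/
def evalGateStmt (arr : ℕ) : Stmt :=
  .set rOp (.load mDesc (ν rPos)) ;; .set rPos (ν rPos + 1) ;; .set rIdx 0 ;; .set rPow 1 ;;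
  .range rJ (.load mInput (2 + ν rOp)) (
    .set rIdx (ν rIdx + .load arr (.load mDesc (ν rPos)) * ν rPow) ;;
    .set rPow (ν rCard * ν rPow) ;; .set rPos (ν rPos + 1)) ;;
  .store arr (3 + ν rGate) (.load mInput (.load mOffset (ν rOp) + ν rIdx))

/-- Evaluate all vertices at the input held by the registers `x, y, z`. -/
def evalStmt (arr x y z : ℕ) : Stmt :=
  .store arr 0 (ν x) ;; .store arr 1 (ν y) ;; .store arr 2 (ν z) ;; .set rPos 0 ;;
  .range rGate (ν rGates) (evalGateStmt arr)

/-- Append a gate whose `j`-th in-neighbour is found in the array `arr` under the `j`-th key. -/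
def emitStmt (arr : ℕ) : Stmt :=
  .store mDesc (ν rLen) (ν rOp) ;; .set rLen (ν rLen + 1) ;;
  .range rJ (ν rArity) (
    .store mDesc (ν rLen) (.load arr (.load mKey (ν rJ))) ;; .set rLen (ν rLen + 1)) ;;
  .set rGates (ν rGates + 1)

/-- Record a triple of vertices under the current key. -/
def insertStmt (u v w : Ex) : Stmt :=
  .store mFound (ν rKey) 1 ;; .store mFst (ν rKey) u ;; .store mSnd (ν rKey) v ;;
  .store mThd (ν rKey) w

/-- Extract the keys of a pair of table entries and check that all of them have been found. -/
def keysStmt : Stmt :=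
  .set rOk 1 ;; .set rX (ν rE1) ;; .set rY (ν rE2) ;;
  .range rJ (ν rArity) (
    .store mKey (ν rJ) (ν rCard * (ν rX % ν rCard) + ν rY % ν rCard) ;;
    .set rX (ν rX / ν rCard) ;; .set rY (ν rY / ν rCard) ;;
    .ite (.load mFound (.load mKey (ν rJ))) .skip (.set rOk 0))

/-- Apply an operation to a tuple of found pairs. -/
def tryStmt : Stmt :=
  keysStmt ;;
  .ite (ν rOk) (
    emitStmt mFst ;; emitStmt mSnd ;; emitStmt mThd ;;
    .set rKey (ν rCard * .load mInput (ν rOffset + ν rE1) + .load mInput (ν rOffset + ν rE2)) ;;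
    insertStmt (ν rGates) (ν rGates + 1) (ν rGates + 2)) .skip

/-- Apply all operations to all tuples of found pairs. -/
def passStmt : Stmt :=
  .range rOp (ν rOps) (
    .set rArity (.load mInput (2 + ν rOp)) ;; .set rTable (.load mTable (ν rOp)) ;;
    .set rOffset (.load mOffset (ν rOp)) ;;
    .range rE1 (ν rTable) (.range rE2 (ν rTable) tryStmt))

/-- Record a triple of vertices held in registers under the key given by its values. -/
def genStmt (u v w : ℕ) : Stmt :=
  .set rKey (ν rCard * .load mVal1 (ν u) + .load mVal2 (ν u)) ;; insertStmt (ν u) (ν v) (ν w)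

/-- Close the three generators under the operations. -/
def closeStmt : Stmt :=
  .range rX (ν rCard * ν rCard) (.store mFound (ν rX) 0) ;;
  genStmt rQ rQ1 rQ2 ;; genStmt rQ1 rQ1 rTR ;; genStmt rT rT rTR ;;
  .range rPass (ν rCard * ν rCard) passStmt

/-- Correct the current operation at one more pair. -/
def roundStmt : Stmt :=
  evalStmt mVal1 rA rB rB ;; evalStmt mVal2 rC rC rD ;; closeStmt ;;
  .set rKey (ν rCard * ν rA + ν rD) ;;
  .ite (.load mFound (ν rKey))
    (.set rQ (.load mFst (ν rKey)) ;; .set rQ1 (.load mSnd (ν rKey)) ;;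
      .set rQ2 (.load mThd (ν rKey)))
    (.set rFail 1)

/-- Correct the current operation at all pairs on the right-hand side. -/
def rightStmt : Stmt :=
  .set rA (ν rLeft / ν rCard) ;; .set rB (ν rLeft % ν rCard) ;;
  .set rQ 0 ;; .set rQ1 (ν rTR) ;; .set rQ2 0 ;;
  .range rRight (ν rCard * ν rCard) (
    .set rC (ν rRight / ν rCard) ;; .set rD (ν rRight % ν rCard) ;; roundStmt) ;;
  .set rT (ν rQ) ;; .set rTR (ν rQ2)

/-- The search for a Maltsev operation. -/
def searchStmt : Stmt :=
  .set rT 2 ;; .set rTR 1 ;; .range rLeft (ν rCard * ν rCard) rightStmt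

/-- Write the result. -/
def outputStmt : Stmt :=
  .ite (ν rFail) (.write 0)
    (.write 1 ;; .write (ν rGates) ;;
      .range rPos (ν rLen) (.write (.load mDesc (ν rPos))) ;; .write (ν rT))

/-- The whole program. -/
def mainStmt : Stmt :=
  .set rCard (.load mInput 0) ;; .set rOps (.load mInput 1) ;;
  .ite (ν rCard - 1) (prelude ;; searchStmt ;; outputStmt) (.write 1 ;; .write 0 ;; .write 2)

/-! ### Resources and configurations -/

variable {A : FinAlgebra} {N K B : ℕ} {σ : State}

/-- The numbers that control the running time. -/
structure Budget (A : FinAlgebra) (N K B : ℕ) : Prop where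
  two_le : 2 ≤ A.card
  card_le : A.card ≤ N
  numOps_le : A.numOps ≤ N
  arity_le : ∀ i, A.arity i ≤ N
  table_le : ∀ i, A.card ^ A.arity i ≤ N
  sq_le : N * N ≤ B
  gates_le : K * (N + 1) ≤ B

theorem Budget.le (h : Budget A N K B) : N ≤ B := (Nat.le_mul_self N).trans h.sq_le

theorem Budget.card_sq_le (h : Budget A N K B) : A.card * A.card ≤ B :=
  (Nat.mul_le_mul h.card_le h.card_le).trans h.sq_le

/-- The registers and arrays describing the algebra. -/
structure Ready (A : FinAlgebra) (σ : State) : Prop where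
  card : σ.reg rCard = A.card
  numOps : σ.reg rOps = A.numOps
  input : ∀ e, σ.mem mInput e = A.code.getD e 0
  offset : ∀ i : Fin A.numOps, σ.mem mOffset i = A.tablePos i
  table : ∀ i : Fin A.numOps, σ.mem mTable i = A.card ^ A.arity i

theorem Ready.congr {τ : State} (h : Ready A σ) (h0 : τ.reg rCard = σ.reg rCard)
    (h1 : τ.reg rOps = σ.reg rOps) (m0 : τ.mem mInput = σ.mem mInput)
    (m1 : τ.mem mOffset = σ.mem mOffset) (m2 : τ.mem mTable = σ.mem mTable) : Ready A τ :=
  ⟨by rw [h0, h.card], by rw [h1, h.numOps], by rw [m0]; exact h.input,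
    by rw [m1]; exact h.offset, by rw [m2]; exact h.table⟩

theorem Ready.arity (h : Ready A σ) (i : Fin A.numOps) : σ.mem mInput (2 + i) = A.arity i := by
  rw [h.input, code_getD_arity]

theorem Ready.op (h : Ready A σ) (i : Fin A.numOps) (f : Fin (A.arity i) → Fin A.card) :
    σ.mem mInput (A.tablePos i + finFunctionFinEquiv f) = A.op i f := by
  rw [h.input, code_getD_table, Equiv.symm_apply_apply]

/-- The circuit under construction is stored in the array of descriptions. -/
structure Holds (σ : State) (gate : ℕ → A.Gate) (G : ℕ) : Prop where
  ordered : Ordered gate G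
  gates : σ.reg rGates = G
  len : σ.reg rLen = pos gate G
  label : ∀ g < G, σ.mem mDesc (pos gate g) = (gate g).1
  nbr : ∀ g < G, ∀ j : Fin (A.arity (gate g).1), σ.mem mDesc (pos gate g + 1 + j) = (gate g).2 j

theorem Holds.congr {τ : State} {gate : ℕ → A.Gate} {G : ℕ} (h : Holds σ gate G)
    (h0 : τ.reg rGates = σ.reg rGates) (h1 : τ.reg rLen = σ.reg rLen)
    (m : τ.mem mDesc = σ.mem mDesc) : Holds τ gate G :=
  ⟨h.ordered, by rw [h0, h.gates], by rw [h1, h.len], by rw [m]; exact h.label,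
    by rw [m]; exact h.nbr⟩

/-! ### Evaluation of the circuit -/

/-- The argument values are accumulated as base-n digits, least significant first, which is the
position of the argument tuple in the operation table. -/
theorem evalGateStmt_spec {gate : ℕ → A.Gate} {G arr g : ℕ} {x : Fin 3 → Fin A.card}
    (hb : Budget A N K B) (hr : Ready A σ) (hh : Holds σ gate G) (hg : g < G)
    (hgate : σ.reg rGate = g) (hp : σ.reg rPos = pos gate g)
    (hv : ∀ v < 3 + g, σ.mem arr v = vals gate x g v) :
    Spec B (evalGateStmt arr) σ fun τ =>
      (∀ v < 3 + (g + 1), τ.mem arr v = vals gate x (g + 1) v) ∧ τ.reg rPos = pos gate (g + 1) := by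
  have hN := hb.le
  unfold evalGateStmt
  simp [hp, hh.label g hg]
  -- The straight-line prefix has been executed by `simp`. Its final state is made opaque, and only
  -- the facts needed later are extracted.
  generalize hσ' : State.setReg _ _ _ = σ'
  have hmem : σ'.mem = σ.mem := by simp [← hσ']
  have hop : σ'.reg rOp = (gate g).1 := by simp [← hσ']
  have hcard : σ'.reg rCard = A.card := by simp [← hσ', hr.card]
  have hgate' : σ'.reg rGate = g := by simp [← hσ', hgate]
  refine Spec.seq (R := fun ρ => ρ.reg rIdx = ∑ l ∈ Finset.range (A.arity (gate g).1),
      σ.mem arr (σ.mem mDesc (pos gate g + 1 + l)) * A.card ^ l ∧ ρ.reg rPos = pos gate (g + 1))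
    (Spec.range (fun j ρ => ρ.reg rIdx = ∑ l ∈ Finset.range j,
      σ.mem arr (σ.mem mDesc (pos gate g + 1 + l)) * A.card ^ l ∧ ρ.reg rPow = A.card ^ j ∧
      ρ.reg rPos = pos gate g + 1 + j) (A.arity (gate g).1) (by simp) ?_ ?_ ?_ ?_ ?_) ?_
  · simp [hop, hmem, hr.arity]
  · exact (hb.arity_le _).trans hN
  · simp [← hσ']
  · intro j hj ρ hf ⟨h1, h2, h3⟩
    have hmem' : ρ.mem = σ.mem := by
      funext a
      rw [hf.mem a (by simp [Stmt.touchesMem]), hmem]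
    have hcard' : ρ.reg rCard = A.card := by rw [hf.reg _ rfl, hcard]
    have hn : σ.mem mDesc (pos gate g + 1 + j) = (gate g).2 ⟨j, hj⟩ := hh.nbr g hg ⟨j, hj⟩
    have hval : σ.mem arr (σ.mem mDesc (pos gate g + 1 + j)) ≤ B := by
      rw [hn, hv _ (hh.ordered g hg _)]
      exact ((Fin.is_lt _).le.trans hb.card_le).trans hN
    simp [h1, h2, h3, hmem', hcard', hval, Finset.sum_range_succ, pow_succ', add_assoc,
      hb.card_le.trans hN]
    rwa [← add_assoc]
  · rintro ρ hf ⟨h1, h2, h3⟩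
    exact ⟨h1, by rw [h3, pos]; lia⟩
  · rintro ρ hf ⟨h1, h2⟩
    have hmem' : ρ.mem = σ.mem := by
      funext a
      rw [hf.mem a (by simp [Stmt.touchesMem]), hmem]
    have hgate'' : ρ.reg rGate = g := by rw [hf.reg _ rfl, hgate']
    have hop'' : ρ.reg rOp = (gate g).1 := by rw [hf.reg _ rfl, hop]
    have key : ∑ l ∈ Finset.range (A.arity (gate g).1),
        σ.mem arr (σ.mem mDesc (pos gate g + 1 + l)) * A.card ^ l =
        finFunctionFinEquiv fun j => vals gate x g ((gate g).2 j) := by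
      rw [finFunctionFinEquiv_apply, ← Fin.sum_univ_eq_sum_range (fun l =>
        σ.mem arr (σ.mem mDesc (pos gate g + 1 + l)) * A.card ^ l)]
      refine Finset.sum_congr rfl fun j _ => ?_
      rw [hh.nbr g hg j, hv _ (hh.ordered g hg j)]
    refine Spec.store_iff.2 ⟨by simp, fun v hv' => ?_, by simpa using h2⟩
    simp [hmem', hgate'', hop'', h1, key, hr.offset, hr.op, vals, Function.update_apply]
    split_ifs with h
    · rw [← hr.op, finFunctionFinEquiv_apply]
    · exact hv v (by lia)

theorem evalStmt_spec {gate : ℕ → A.Gate} {G arr rx ry rz : ℕ} {x : Fin 3 → Fin A.card}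
    (hb : Budget A N K B) (hr : Ready A σ) (hh : Holds σ gate G) (hG : G ≤ K) (harr : 3 < arr)
    (hx : σ.reg rx = x 0) (hy : σ.reg ry = x 1) (hz : σ.reg rz = x 2) :
    Spec B (evalStmt arr rx ry rz) σ fun τ => ∀ v < 3 + G, τ.mem arr v = vals gate x G v := by
  have ha : ∀ a < 4, a ≠ arr := by lia
  unfold evalStmt
  simp [hx, hy, hz]
  generalize hσ' : State.setReg _ _ _ = σ'
  have hmem : ∀ a < 4, σ'.mem a = σ.mem a := fun a h => by simp [← hσ', ha a h]
  have hreg : ∀ r, r ≠ rPos → σ'.reg r = σ.reg r := fun r h => by simp [← hσ', h]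
  refine Spec.range (fun g τ => (∀ v < 3 + g, τ.mem arr v = vals gate x g v) ∧
    τ.reg rPos = pos gate g) G (by simp) ?_ ?_ ?_ ?_ ?_
  · simp [hreg, hh.gates]
  · have := hb.gates_le
    nlinarith
  · refine ⟨fun v hv => ?_, by simp [← hσ', pos]⟩
    have h3 : v = 0 ∨ v = 1 ∨ v = 2 := by lia
    rcases h3 with rfl | rfl | rfl <;> simp [← hσ', vals, Function.update_apply]
  · intro g hg τ hf ⟨hv, hp⟩
    have hmem' : ∀ a < 4, τ.mem a = σ.mem a := fun a h => by
      rw [hf.mem a (by simp [Stmt.touchesMem, evalGateStmt, ha a h]), hmem a h]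
    refine evalGateStmt_spec hb (hr.congr ?_ ?_ ?_ ?_ ?_) (hh.congr ?_ ?_ ?_) hg
      (by simp) (by simpa using hp) (by simpa using hv)
    all_goals first
      | exact hmem' _ (by lia)
      | simp only [State.setReg_reg]; rw [if_neg (by lia), hf.reg _ rfl, hreg _ (by lia)]
  · exact fun τ _ h => h.1

/-! ### Appending gates -/

/-- The old gates occupy only cells below `pos gate G`, the first free one, so the new description
cannot damage them. -/
theorem Holds.snoc {τ : State} {gate gate' : ℕ → A.Gate} {G : ℕ} (h : Holds σ gate G)
    {i : Fin A.numOps} {nb : Fin (A.arity i) → ℕ} (hold : ∀ g < G, gate' g = gate g)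
    (hnew : gate' G = ⟨i, nb⟩) (hlt : ∀ j, nb j < 3 + G) (hG : τ.reg rGates = G + 1)
    (hL : τ.reg rLen = pos gate G + (1 + A.arity i))
    (hmem : ∀ p < pos gate G, τ.mem mDesc p = σ.mem mDesc p)
    (hlabel : τ.mem mDesc (pos gate G) = i)
    (hnbr : ∀ j : Fin (A.arity i), τ.mem mDesc (pos gate G + 1 + j) = nb j) : Holds τ gate' (G + 1) := by
  have hpos : ∀ g ≤ G, pos gate' g = pos gate g := fun g hg =>
    pos_congr fun g' hg' => hold g' (by lia)
  refine ⟨fun g hg => ?_, hG, ?_, fun g hg => ?_, fun g hg => ?_⟩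
  · rcases Nat.lt_succ_iff_lt_or_eq.1 hg with hg | rfl
    · rw [hold g hg]; exact h.ordered g hg
    · rw [hnew]; exact hlt
  · rw [hL, pos, hpos G le_rfl, hnew]
  · rw [hpos g (by lia)]
    rcases Nat.lt_succ_iff_lt_or_eq.1 hg with hg | rfl
    · have : pos gate (g + 1) ≤ pos gate G := pos_mono gate hg
      rw [hold g hg, hmem _ (by rw [pos] at this; lia), h.label g hg]
    · rw [hnew, hlabel]
  · rw [hpos g (by lia)]
    rcases Nat.lt_succ_iff_lt_or_eq.1 hg with hg | rfl
    · have : pos gate (g + 1) ≤ pos gate G := pos_mono gate hg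
      rw [hold g hg]
      intro j
      rw [hmem _ (by rw [pos] at this; have := j.2; lia), h.nbr g hg]
    · rw [hnew]; exact hnbr

theorem emitStmt_spec {gate : ℕ → A.Gate} {G arr : ℕ} {i : Fin A.numOps}
    {nb : Fin (A.arity i) → ℕ} (hb : Budget A N K B) (hh : Holds σ gate G) (harr : 3 < arr)
    (hop : σ.reg rOp = i) (har : σ.reg rArity = A.arity i)
    (hnb : ∀ j : Fin (A.arity i), σ.mem arr (σ.mem mKey j) = nb j) (hlt : ∀ j, nb j < 3 + G) :
    Spec B (emitStmt arr) σ fun τ => Holds τ (Function.update gate G ⟨i, nb⟩) (G + 1) := by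
  unfold emitStmt
  simp [hop, hh.len]
  generalize hσ' : State.setReg _ _ _ = σ'
  have hmem : ∀ a, a ≠ 3 → σ'.mem a = σ.mem a := fun a h => by simp [← hσ', h]
  refine Spec.seq (R := fun τ => τ.reg rLen = pos gate G + 1 + A.arity i ∧
      (∀ p ≤ pos gate G, τ.mem mDesc p = σ'.mem mDesc p) ∧
      ∀ l (hl : l < A.arity i), τ.mem mDesc (pos gate G + 1 + l) = nb ⟨l, hl⟩)
    (Spec.range (fun j τ => τ.reg rLen = pos gate G + 1 + j ∧
      (∀ p ≤ pos gate G, τ.mem mDesc p = σ'.mem mDesc p) ∧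
      ∀ l (hl : l < A.arity i), l < j → τ.mem mDesc (pos gate G + 1 + l) = nb ⟨l, hl⟩)
      (A.arity i) (by simp) ?_ ?_ ?_ ?_ ?_) ?_
  · simp [← hσ', har]
  · exact (hb.arity_le _).trans hb.le
  · simp [← hσ']
  · intro j hj τ hf ⟨h1, h2, h3⟩
    have hmem' : ∀ a, a ≠ 3 → τ.mem a = σ.mem a := fun a h => by
      rw [hf.mem a (by simp [Stmt.touchesMem, h]), hmem a h]
    simp [h1]
    refine ⟨by lia, fun p hp => ?_, fun l hl hlj => ?_⟩
    · rw [Function.update_of_ne (by lia), h2 p hp]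
    · rcases Nat.le_iff_lt_or_eq.1 hlj with h | rfl
      · rw [Function.update_of_ne (by lia), h3 l hl h]
      · rw [Function.update_self, hmem' _ (by lia), hmem' _ (by lia)]
        exact hnb ⟨l, hl⟩
  · exact fun τ hf ⟨h1, h2, h3⟩ => ⟨h1, h2, fun l hl => h3 l hl hl⟩
  · intro τ hf ⟨h1, h2, h3⟩
    have hg : τ.reg rGates = G := by rw [hf.reg _ rfl]; simp [← hσ', hh.gates]
    refine Spec.set_iff.2 ⟨by simp, ?_⟩
    refine hh.snoc (fun g hg => Function.update_of_ne hg.ne _ _) (Function.update_self ..) hlt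
      (by simp [hg]) (by simp [h1]; lia) (fun p hp => ?_) ?_ fun j => ?_
    · simp [h2 p hp.le, ← hσ', Function.update_of_ne hp.ne]
    · simp [h2 _ le_rfl, ← hσ']
    · simpa using h3 j j.2

/-! ### Keys -/

/-- The number under which a pair is stored. -/
def key (y : Fin A.card × Fin A.card) : ℕ := A.card * y.1 + y.2

theorem key_injective : Function.Injective (key (A := A)) := by
  rintro ⟨u, w⟩ ⟨u', w'⟩ h
  simp only [key] at h
  have h1 := congrArg (· / A.card) h
  have h2 := congrArg (· % A.card) h
  have h0 : 0 < A.card := u.pos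
  simp only [Nat.mul_add_div h0, Nat.mul_add_mod, Nat.div_eq_of_lt w.2, Nat.div_eq_of_lt w'.2,
    Nat.mod_eq_of_lt w.2, Nat.mod_eq_of_lt w'.2, add_zero] at h1 h2
  exact Prod.ext (Fin.ext h1) (Fin.ext h2)

theorem key_lt (y : Fin A.card × Fin A.card) : key y < A.card * A.card := by
  have h1 := y.1.2
  have h2 := y.2.2
  unfold key
  nlinarith

/-- The pairs that have been recorded. -/
def found (A : FinAlgebra) (σ : State) : Set (Fin A.card × Fin A.card) :=
  {y | σ.mem mFound (key y) ≠ 0}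

theorem finFunctionFinEquiv_div_mod {m n : ℕ} (f : Fin m → Fin n) (j : Fin m) :
    (finFunctionFinEquiv f : ℕ) / n ^ (j : ℕ) % n = f j := by
  conv_rhs => rw [← Equiv.symm_apply_apply finFunctionFinEquiv f]
  rfl

/-- Repeated division by n peels the digits off the two table positions; the `j`-th digits are `α j`
and `β j`, and together they give the `j`-th key. -/
theorem keysStmt_spec {i : Fin A.numOps} {α β : Fin (A.arity i) → Fin A.card}
    (hb : Budget A N K B) (hr : Ready A σ) (har : σ.reg rArity = A.arity i)
    (h1 : σ.reg rE1 = finFunctionFinEquiv α) (h2 : σ.reg rE2 = finFunctionFinEquiv β) :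
    Spec B keysStmt σ fun τ => (∀ j : Fin (A.arity i), τ.mem mKey j = key (α j, β j)) ∧
      (τ.reg rOk ≠ 0 ↔ ∀ j, (α j, β j) ∈ found A σ) := by
  have hN := hb.le
  have hn0 : 0 < A.card := by have := hb.two_le; lia
  have hle : ∀ (f : Fin (A.arity i) → Fin A.card) j,
      (finFunctionFinEquiv f : ℕ) / A.card ^ j ≤ B := fun f j =>
    (Nat.div_le_self _ _).trans ((Fin.is_lt _).le.trans ((hb.table_le i).trans hN))
  unfold keysStmt
  simp [h1, h2, -finFunctionFinEquiv_apply_val]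
  generalize hσ' : State.setReg _ _ _ = σ'
  refine Spec.range (fun j τ => τ.reg rX = finFunctionFinEquiv α / A.card ^ j ∧
    τ.reg rY = finFunctionFinEquiv β / A.card ^ j ∧
    (∀ l : Fin (A.arity i), (l : ℕ) < j → τ.mem mKey l = key (α l, β l)) ∧
    (τ.reg rOk ≠ 0 ↔ ∀ l : Fin (A.arity i), (l : ℕ) < j → (α l, β l) ∈ found A σ))
    (A.arity i) (by simp) ?_ ?_ ?_ ?_ ?_
  · simp [← hσ', har]
  · exact (hb.arity_le _).trans hN
  · simp [← hσ']
  · intro j hj τ hf ⟨h1, h2, h3, h4⟩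
    have hc : τ.reg rCard = A.card := by rw [hf.reg _ rfl]; simp [← hσ', hr.card]
    have hm : τ.mem mFound = σ.mem mFound := by rw [hf.mem _ rfl]; simp [← hσ']
    have e1 := finFunctionFinEquiv_div_mod α ⟨j, hj⟩
    have e2 := finFunctionFinEquiv_div_mod β ⟨j, hj⟩
    have hk : A.card * (α ⟨j, hj⟩ : ℕ) + β ⟨j, hj⟩ = key (α ⟨j, hj⟩, β ⟨j, hj⟩) := rfl
    simp only [] at e1 e2
    have hkeys : ∀ l : Fin (A.arity i), (l : ℕ) < j + 1 →
        Function.update (τ.mem mKey) j (key (α ⟨j, hj⟩, β ⟨j, hj⟩)) l = key (α l, β l) := by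
      intro l hl
      rcases Nat.lt_succ_iff_lt_or_eq.1 hl with h | rfl
      · rw [Function.update_of_ne (by lia), h3 l h]
      · rw [Function.update_self]
    have hall : (∀ l : Fin (A.arity i), (l : ℕ) < j + 1 → (α l, β l) ∈ found A σ) ↔
        (τ.reg rOk ≠ 0 ∧ (α ⟨j, hj⟩, β ⟨j, hj⟩) ∈ found A σ) := by
      rw [h4]
      refine ⟨fun h => ⟨fun l hl => h l (by lia), h ⟨j, hj⟩ (by simp)⟩, fun h l hl => ?_⟩
      rcases Nat.lt_succ_iff_lt_or_eq.1 hl with h' | rfl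
      exacts [h.1 l h', h.2]
    simp only [Spec.store_seq_iff, Spec.set_seq_iff, Spec.ite_iff, Spec.skip_iff, Spec.set_iff]
    simp [h1, h2, hc, e1, e2, hk, hle, hn0, hb.card_le.trans hN, Nat.div_div_eq_div_mul,
      pow_succ, hm, -finFunctionFinEquiv_apply_val]
    simp only [Nat.lt_succ_iff] at hkeys hall
    refine ⟨fun h => ⟨hkeys, ?_⟩, fun h => ⟨hkeys, ⟨j, hj⟩, le_rfl, by simpa [found] using h⟩⟩
    rw [hall, and_iff_left (by simpa [found] using h)]
  · exact fun τ hf ⟨h1, h2, h3, h4⟩ => ⟨fun j => h3 j j.2, h4.trans (by simp)⟩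

/-! ### Closing the generators under the operations -/

variable (A) in
/-- Three substitutions, and two inputs at which the first one is evaluated. -/
structure Target where
  X : (Fin 3 → Fin A.card) → Fin 3 → Fin A.card
  Y : (Fin 3 → Fin A.card) → Fin 3 → Fin A.card
  Z : (Fin 3 → Fin A.card) → Fin 3 → Fin A.card
  e1 : Fin 3 → Fin A.card
  e2 : Fin 3 → Fin A.card

/-- The vertices `v1, v2, v3` compute the same idempotent operation after the three substitutions,
and the values of `v1` at the two inputs are given. -/
structure Entry (S : Target A) (gate : ℕ → A.Gate) (G : ℕ) (y : Fin A.card × Fin A.card)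
    (v1 v2 v3 : ℕ) : Prop where
  lt1 : v1 < 3 + G
  lt2 : v2 < 3 + G
  lt3 : v3 < 3 + G
  subst : ∃ r : (Fin 3 → Fin A.card) → Fin A.card, (∀ a, r (fun _ => a) = a) ∧ ∀ x,
    vals gate x G v1 = r (S.X x) ∧ vals gate x G v2 = r (S.Y x) ∧ vals gate x G v3 = r (S.Z x)
  val1 : vals gate S.e1 G v1 = y.1
  val2 : vals gate S.e2 G v1 = y.2

variable {S : Target A} {gate gate' gate₀ : ℕ → A.Gate} {G G' G₀ : ℕ}

theorem Entry.extend {y : Fin A.card × Fin A.card} {v1 v2 v3 : ℕ}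
    (h : Entry S gate G y v1 v2 v3) (hG : G ≤ G') (hg : ∀ g < G, gate' g = gate g) :
    Entry S gate' G' y v1 v2 v3 where
  lt1 := h.lt1.trans_le (by lia)
  lt2 := h.lt2.trans_le (by lia)
  lt3 := h.lt3.trans_le (by lia)
  subst := by
    obtain ⟨r, hr, hx⟩ := h.subst
    refine ⟨r, hr, fun x => ?_⟩
    rw [vals_extend hG hg h.lt1, vals_extend hG hg h.lt2, vals_extend hG hg h.lt3]
    exact hx x
  val1 := by rw [vals_extend hG hg h.lt1, h.val1]
  val2 := by rw [vals_extend hG hg h.lt1, h.val2]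

theorem vals_of_gate_eq (ho : Ordered gate G) {g : ℕ} (hg : g < G) {i : Fin A.numOps}
    {nb : Fin (A.arity i) → ℕ} (h : gate g = ⟨i, nb⟩) (x : Fin 3 → Fin A.card) :
    vals gate x G (3 + g) = A.op i fun j => vals gate x G (nb j) := by
  rw [vals_gate ho hg, h]

/-- Applying an operation to entries. -/
theorem Entry.op (hA : A.IsIdempotent) {i : Fin A.numOps} {α β : Fin (A.arity i) → Fin A.card}
    {v1 v2 v3 : Fin (A.arity i) → ℕ} (ho : Ordered gate G)
    (h : ∀ j, Entry S gate G (α j, β j) (v1 j) (v2 j) (v3 j)) {g1 g2 g3 : ℕ} (h1 : g1 < G)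
    (h2 : g2 < G) (h3 : g3 < G) (hg1 : gate g1 = ⟨i, v1⟩) (hg2 : gate g2 = ⟨i, v2⟩)
    (hg3 : gate g3 = ⟨i, v3⟩) :
    Entry S gate G (A.op i α, A.op i β) (3 + g1) (3 + g2) (3 + g3) where
  lt1 := by lia
  lt2 := by lia
  lt3 := by lia
  subst := by
    choose r hr hx using fun j => (h j).subst
    refine ⟨fun x => A.op i fun j => r j x, fun a => ?_, fun x => ?_⟩
    · simp only [hr, hA i a]
    · rw [vals_of_gate_eq ho h1 hg1, vals_of_gate_eq ho h2 hg2, vals_of_gate_eq ho h3 hg3]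
      simp only [hx, and_self]
  val1 := by
    rw [vals_of_gate_eq ho h1 hg1]
    simp only [fun j => (h j).val1]
  val2 := by
    rw [vals_of_gate_eq ho h1 hg1]
    simp only [fun j => (h j).val2]

/-- All recorded triples are entries for their keys. -/
def Recorded (S : Target A) (gate : ℕ → A.Gate) (G : ℕ) (σ : State) : Prop :=
  ∀ y ∈ found A σ, Entry S gate G y (σ.mem mFst (key y)) (σ.mem mSnd (key y)) (σ.mem mThd (key y))

theorem Recorded.extend (h : Recorded S gate G σ) (hG : G ≤ G')
    (hg : ∀ g < G, gate' g = gate g) : Recorded S gate' G' σ :=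
  fun y hy => (h y hy).extend hG hg

theorem found_congr {τ : State} (h : τ.mem mFound = σ.mem mFound) : found A τ = found A σ := by
  simp only [found, h]

theorem Recorded.congr {τ : State} (h : Recorded S gate G σ)
    (h6 : τ.mem mFound = σ.mem mFound) (h7 : τ.mem mFst = σ.mem mFst)
    (h8 : τ.mem mSnd = σ.mem mSnd) (h9 : τ.mem mThd = σ.mem mThd) : Recorded S gate G τ := by
  unfold Recorded
  rw [found_congr h6, h7, h8, h9]
  exact h

/-- An older triple under the same key may be overwritten, since any entry for `y` is as good as
another. The hypotheses on `u`, `v`, `w` range over all states with the same registers because the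
memory changes between the stores. -/
theorem insertStmt_spec {y : Fin A.card × Fin A.card} {u v w : Ex} {v1 v2 v3 : ℕ}
    (h : Recorded S gate G σ) (hk : σ.reg rKey = key y) (he : Entry S gate G y v1 v2 v3)
    (hu : ∀ τ : State, τ.reg = σ.reg → u.Safe B τ ∧ u.eval τ = v1)
    (hv : ∀ τ : State, τ.reg = σ.reg → v.Safe B τ ∧ v.eval τ = v2)
    (hw : ∀ τ : State, τ.reg = σ.reg → w.Safe B τ ∧ w.eval τ = v3) :
    Spec B (insertStmt u v w) σ fun τ => Recorded S gate G τ ∧ found A τ = insert y (found A σ) := by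
  unfold insertStmt
  have e1 := hu (σ.setMem mFound (key y) 1) rfl
  have e2 := hv ((σ.setMem mFound (key y) 1).setMem mFst (key y) v1) rfl
  have e3 := hw (((σ.setMem mFound (key y) 1).setMem mFst (key y) v1).setMem mSnd (key y) v2) rfl
  simp [hk, e1, e2, e3]
  have hf : ∀ τ : State, τ.mem mFound = Function.update (σ.mem mFound) (key y) 1 →
      found A τ = insert y (found A σ) := by
    intro τ hτ
    ext z
    simp only [found, hτ, Set.mem_ofPred_eq, Set.mem_insert_iff]
    by_cases hz : z = y
    · simp [hz]
    · simp [Function.update_of_ne (key_injective.ne hz), hz]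
  refine ⟨fun z hz => ?_, hf _ (by simp)⟩
  rw [hf _ (by simp)] at hz
  by_cases hzy : z = y
  · subst hzy
    simpa using he
  · have := h z (hz.resolve_left hzy)
    simpa [Function.update_of_ne (key_injective.ne hzy)] using this

/-- The circuit extends a given one, and all recorded triples are entries. -/
structure Closing (S : Target A) (gate₀ : ℕ → A.Gate) (G₀ : ℕ) (σ : State) : Prop where
  ready : Ready A σ
  exists_gate : ∃ gate G, Holds σ gate G ∧ G₀ ≤ G ∧ (∀ g < G₀, gate g = gate₀ g) ∧
    Recorded S gate G σ

theorem Closing.congr {τ : State} (h : Closing S gate₀ G₀ σ) (hr : ∀ r < 14, τ.reg r = σ.reg r)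
    (hm : τ.mem = σ.mem) : Closing S gate₀ G₀ τ := by
  obtain ⟨h1, gate, G, h2, h3, h4, h5⟩ := h
  exact ⟨h1.congr (hr _ (by simp)) (hr _ (by simp)) (by rw [hm]) (by rw [hm]) (by rw [hm]),
    gate, G, h2.congr (hr _ (by simp)) (hr _ (by simp)) (by rw [hm]), h3, h4,
    h5.congr (by rw [hm]) (by rw [hm]) (by rw [hm]) (by rw [hm])⟩

/-- The result of a part of the closure computation: at most `c` new gates, and everything in `F`
has been found. -/
structure Closed (S : Target A) (gate₀ : ℕ → A.Gate) (G₀ c : ℕ) (F : Set (Fin A.card × Fin A.card))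
    (σ τ : State) : Prop where
  closing : Closing S gate₀ G₀ τ
  found_mono : found A σ ⊆ found A τ
  gates_le : τ.reg rGates ≤ σ.reg rGates + c
  subset : F ⊆ found A τ

/-- The same operation is applied to the first, second and third vertices of the argument entries,
so the three new gates again share one idempotent operation. Gates are added even if the resulting
pair is already known; only the number of trials enters the bound. -/
theorem tryStmt_spec (hA : A.IsIdempotent) (hb : Budget A N K B) (h : Closing S gate₀ G₀ σ)
    {i : Fin A.numOps} {α β : Fin (A.arity i) → Fin A.card} (hop : σ.reg rOp = i)
    (har : σ.reg rArity = A.arity i) (hoff : σ.reg rOffset = A.tablePos i)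
    (h1 : σ.reg rE1 = finFunctionFinEquiv α) (h2 : σ.reg rE2 = finFunctionFinEquiv β) :
    Spec B tryStmt σ (Closed S gate₀ G₀ 3
      {y | y = (A.op i α, A.op i β) ∧ ∀ j, (α j, β j) ∈ found A σ} σ) := by
  obtain ⟨hr, gate, G, hh, hG, hgate, hrec⟩ := h
  refine Spec.seq (keysStmt_spec hb hr har h1 h2) fun τ hf ⟨hk, hok⟩ => ?_
  have hr' : Ready A τ := hr.congr (hf.reg _ rfl) (hf.reg _ rfl) (hf.mem _ rfl) (hf.mem _ rfl)
    (hf.mem _ rfl)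
  have hh' : Holds τ gate G := hh.congr (hf.reg _ rfl) (hf.reg _ rfl) (hf.mem _ rfl)
  have hfound : found A τ = found A σ := found_congr (hf.mem _ rfl)
  have hrec' : Recorded S gate G τ := hrec.congr (hf.mem _ rfl) (hf.mem _ rfl) (hf.mem _ rfl)
    (hf.mem _ rfl)
  refine Spec.ite_iff.2 ⟨by simp, fun hc => ?_, fun hc => ?_⟩
  · have hall := hok.1 hc
    have hent := fun j => hrec' _ (hfound ▸ hall j)
    refine Spec.seq (emitStmt_spec (nb := fun j => τ.mem mFst (key (α j, β j))) hb hh' (by simp)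
      (by rw [hf.reg _ rfl, hop]) (by rw [hf.reg _ rfl, har]) (fun j => by rw [hk])
      fun j => (hent j).lt1) fun τ1 f1 hh1 => ?_
    refine Spec.seq (emitStmt_spec (nb := fun j => τ.mem mSnd (key (α j, β j))) hb hh1 (by simp)
      (by rw [f1.reg _ rfl, hf.reg _ rfl, hop]) (by rw [f1.reg _ rfl, hf.reg _ rfl, har])
      (fun j => by rw [f1.mem _ rfl, f1.mem _ rfl, hk])
      fun j => (hent j).lt2.trans (by lia)) fun τ2 f2 hh2 => ?_
    refine Spec.seq (emitStmt_spec (nb := fun j => τ.mem mThd (key (α j, β j))) hb hh2 (by simp)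
      (by rw [f2.reg _ rfl, f1.reg _ rfl, hf.reg _ rfl, hop])
      (by rw [f2.reg _ rfl, f1.reg _ rfl, hf.reg _ rfl, har])
      (fun j => by rw [f2.mem _ rfl, f2.mem _ rfl, f1.mem _ rfl, f1.mem _ rfl, hk])
      fun j => (hent j).lt3.trans (by lia)) fun τ3 f3 hh3 => ?_
    generalize hgate' : Function.update (Function.update (Function.update gate G _) (G + 1) _)
      (G + 1 + 1) _ = gate' at hh3
    have hold : ∀ g < G, gate' g = gate g := fun g hg => by
      rw [← hgate', Function.update_of_ne (by lia), Function.update_of_ne (by lia),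
        Function.update_of_ne (by lia)]
    have hr3 : Ready A τ3 := hr'.congr (by rw [f3.reg _ rfl, f2.reg _ rfl, f1.reg _ rfl])
      (by rw [f3.reg _ rfl, f2.reg _ rfl, f1.reg _ rfl])
      (by rw [f3.mem _ rfl, f2.mem _ rfl, f1.mem _ rfl])
      (by rw [f3.mem _ rfl, f2.mem _ rfl, f1.mem _ rfl])
      (by rw [f3.mem _ rfl, f2.mem _ rfl, f1.mem _ rfl])
    have hrec3 : Recorded S gate' (G + 1 + 1 + 1) τ3 := (hrec'.congr
      (by rw [f3.mem _ rfl, f2.mem _ rfl, f1.mem _ rfl])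
      (by rw [f3.mem _ rfl, f2.mem _ rfl, f1.mem _ rfl])
      (by rw [f3.mem _ rfl, f2.mem _ rfl, f1.mem _ rfl])
      (by rw [f3.mem _ rfl, f2.mem _ rfl, f1.mem _ rfl])).extend (by lia) hold
    have hent3 : Entry S gate' (G + 1 + 1 + 1) (A.op i α, A.op i β) (3 + G) (3 + (G + 1))
        (3 + (G + 1 + 1)) :=
      Entry.op hA hh3.ordered (fun j => (hent j).extend (by lia) hold) (by lia) (by lia) (by lia)
        (by rw [← hgate', Function.update_of_ne (by lia), Function.update_of_ne (by lia),
          Function.update_self])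
        (by rw [← hgate', Function.update_of_ne (by lia), Function.update_self])
        (by rw [← hgate', Function.update_self])
    have eo : τ3.reg rOffset = A.tablePos i := by
      rw [f3.reg _ rfl, f2.reg _ rfl, f1.reg _ rfl, hf.reg _ rfl, hoff]
    have e1 : τ3.reg rE1 = finFunctionFinEquiv α := by
      rw [f3.reg _ rfl, f2.reg _ rfl, f1.reg _ rfl, hf.reg _ rfl, h1]
    have e2 : τ3.reg rE2 = finFunctionFinEquiv β := by
      rw [f3.reg _ rfl, f2.reg _ rfl, f1.reg _ rfl, hf.reg _ rfl, h2]
    refine Spec.set_seq_iff.2 ⟨by simp [hr3.card, hb.card_le.trans hb.le], ?_⟩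
    generalize hτ4 : State.setReg _ _ _ = τ4
    have hreg : ∀ r, r ≠ 23 → τ4.reg r = τ3.reg r := fun r h => by simp [← hτ4, h]
    have hmem : τ4.mem = τ3.mem := by simp [← hτ4]
    have hkey : τ4.reg rKey = key (A.op i α, A.op i β) := by
      simp [← hτ4, hr3.card, eo, e1, e2, hr3.op, key, -finFunctionFinEquiv_apply_val]
    have hg4 : τ4.reg rGates = G + 1 + 1 + 1 := by rw [hreg _ (by simp), hh3.gates]
    have hrec4 : Recorded S gate' (G + 1 + 1 + 1) τ4 := hrec3.congr (by rw [hmem]) (by rw [hmem])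
      (by rw [hmem]) (by rw [hmem])
    refine Spec.mono (Spec.frame (insertStmt_spec hrec4 hkey hent3 (fun ρ hρ => ?_)
      (fun ρ hρ => ?_) fun ρ hρ => ?_)) ?_
    · simp [hρ, hg4]; lia
    · simp [hρ, hg4]; lia
    · simp [hρ, hg4]; lia
    · rintro ρ ⟨⟨hρ1, hρ2⟩, hfρ⟩
      have hf4 : found A τ4 = found A σ := by
        rw [← hfound]
        exact found_congr (by rw [hmem, f3.mem _ rfl, f2.mem _ rfl, f1.mem _ rfl])
      rw [hf4] at hρ2
      refine ⟨⟨hr3.congr (by rw [hfρ.reg _ rfl, hreg _ (by simp)])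
        (by rw [hfρ.reg _ rfl, hreg _ (by simp)]) (by rw [hfρ.mem _ rfl, hmem])
        (by rw [hfρ.mem _ rfl, hmem]) (by rw [hfρ.mem _ rfl, hmem]),
        gate', _, hh3.congr (by rw [hfρ.reg _ rfl, hreg _ (by simp)])
        (by rw [hfρ.reg _ rfl, hreg _ (by simp)]) (by rw [hfρ.mem _ rfl, hmem]), by lia,
        fun g hg => (hold g (by lia)).trans (hgate g hg), hρ1⟩, ?_, ?_, ?_⟩
      · rw [hρ2]; exact Set.subset_insert _ _
      · rw [hfρ.reg _ rfl, hg4, hh.gates]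
      · rw [hρ2]
        rintro y ⟨rfl, -⟩
        exact Set.mem_insert _ _
  · refine Spec.skip_iff.2 ⟨⟨hr', gate, G, hh', hG, hgate, hrec'⟩, hfound.ge, ?_, ?_⟩
    · rw [hf.reg _ rfl]; lia
    · rintro y ⟨-, hy⟩
      exact absurd hc (hok.2 hy)

/-- A loop all of whose rounds are parts of the closure computation. -/
theorem Closed.range {s : Stmt} {e : Ex} {r : ℕ} (c n : ℕ) (F : ℕ → Set (Fin A.card × Fin A.card))
    (h : Closing S gate₀ G₀ σ) (hr : 14 ≤ r) (he : e.Safe B σ) (hn : e.eval σ = n)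
    (hB : n ≤ B)
    (hstep : ∀ k < n, ∀ τ, Frame (.range r e s) σ τ → Closing S gate₀ G₀ τ →
      found A σ ⊆ found A τ → (∀ l < k, F l ⊆ found A τ) →
      Spec B s (τ.setReg r k) (Closed S gate₀ G₀ c (F k) (τ.setReg r k))) :
    Spec B (.range r e s) σ (Closed S gate₀ G₀ (n * c) (⋃ k < n, F k) σ) := by
  refine Spec.range (fun k τ => Closed S gate₀ G₀ (k * c) (⋃ l < k, F l) σ τ) n he hn hB ?_ ?_
    fun τ _ hτ => hτ
  · exact ⟨h, subset_rfl, by simp, by simp⟩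
  · intro k hk τ hf hτ
    have hsub := hτ.subset
    simp only [Set.iUnion_subset_iff] at hsub
    refine (hstep k hk τ hf hτ.closing hτ.found_mono hsub).mono fun ρ hρ => ?_
    have h1 : found A τ ⊆ found A ρ := hρ.found_mono
    refine ⟨hρ.closing, hτ.found_mono.trans h1, ?_, ?_⟩
    · have h2 := hρ.gates_le
      have h3 := hτ.gates_le
      rw [State.setReg_reg, if_neg (by lia)] at h2
      rw [Nat.succ_mul]
      lia
    · simp only [Set.iUnion_subset_iff]
      intro l hl
      rcases Nat.lt_succ_iff_lt_or_eq.1 hl with hl | rfl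
      exacts [(hsub l hl).trans h1, hρ.subset]

theorem Closed.mono {c c' : ℕ} {F F' : Set (Fin A.card × Fin A.card)} {τ : State}
    (h : Closed S gate₀ G₀ c F σ τ) (hc : c ≤ c') (hF : F' ⊆ F) : Closed S gate₀ G₀ c' F' σ τ :=
  ⟨h.closing, h.found_mono, h.gates_le.trans (by lia), hF.trans h.subset⟩

/-- The images of found pairs under one operation. -/
def images (A : FinAlgebra) (P : Set (Fin A.card × Fin A.card)) (i : ℕ) :
    Set (Fin A.card × Fin A.card) :=
  {y | ∃ (i' : Fin A.numOps) (α β : Fin (A.arity i') → Fin A.card), (i' : ℕ) = i ∧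
    (∀ j, (α j, β j) ∈ P) ∧ y = (A.op i' α, A.op i' β)}

/-- A tuple of pairs is a pair of tuples, hence a pair of positions in one table; this gives three
factors `N` and three gates per trial. Pairs found during the pass may already be used in it, which
is harmless because `found` only grows. -/
theorem passStmt_spec (hA : A.IsIdempotent) (hb : Budget A N K B) (h : Closing S gate₀ G₀ σ) :
    Spec B passStmt σ (Closed S gate₀ G₀ (N * (N * (N * 3)))
      (⋃ i < A.numOps, images A (found A σ) i) σ) := by
  have hN := hb.le
  unfold passStmt
  refine (Closed.range (N * (N * 3)) A.numOps (images A (found A σ)) h (by simp) (by simp)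
    (by simp [h.ready.numOps]) (hb.numOps_le.trans hN) ?_).mono
    fun τ hτ => hτ.mono (Nat.mul_le_mul_right _ hb.numOps_le) subset_rfl
  intro k hk τ hf hτ hsub _
  obtain ⟨i, rfl⟩ : ∃ i : Fin A.numOps, (i : ℕ) = k := ⟨⟨k, hk⟩, rfl⟩
  simp [hτ.ready.table, hτ.ready.offset, hτ.ready.arity]
  generalize hσ' : State.setReg (State.setReg (State.setReg _ _ _) _ _) _ _ = σ'
  have hop : σ'.reg rOp = i := by simp [← hσ']
  have har : σ'.reg rArity = A.arity i := by simp [← hσ']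
  have htab : σ'.reg rTable = A.card ^ A.arity i := by simp [← hσ']
  have hoff : σ'.reg rOffset = A.tablePos i := by simp [← hσ']
  have hreg : ∀ r < 14, σ'.reg r = (τ.setReg rOp i).reg r := fun r hr => by
    simp [← hσ', (show r ≠ 15 by lia), (show r ≠ 16 by lia), (show r ≠ 17 by lia)]
  have hreg' : ∀ r < 14, σ'.reg r = τ.reg r := fun r hr => by
    rw [hreg r hr]; simp [(show r ≠ 14 by lia)]
  have hmem : σ'.mem = τ.mem := by simp [← hσ']
  have hc' : Closing S gate₀ G₀ σ' := hτ.congr hreg' hmem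
  have hfs : found A σ' = found A τ := found_congr (by rw [hmem])
  have hT := hb.table_le i
  refine (Closed.range (N * 3) (A.card ^ A.arity i) (fun k => {y | ∃ α β : Fin (A.arity i) →
      Fin A.card, (finFunctionFinEquiv α : ℕ) = k ∧ (∀ j, (α j, β j) ∈ found A σ) ∧
      y = (A.op i α, A.op i β)}) hc' (by simp) (by simp) (by simp [htab]) (hT.trans hN) ?_).mono ?_
  · intro k1 hk1 τ1 hf1 hτ1 hsub1 _
    refine (Closed.range 3 (A.card ^ A.arity i) (fun k => {y | ∃ α β : Fin (A.arity i) →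
      Fin A.card, (finFunctionFinEquiv α : ℕ) = k1 ∧ (finFunctionFinEquiv β : ℕ) = k ∧
      (∀ j, (α j, β j) ∈ found A σ) ∧ y = (A.op i α, A.op i β)})
      (hτ1.congr (fun r hr => by simp [(show r ≠ 18 by lia)]) (by simp)) (by simp) (by simp)
      (by simp [hf1.reg rTable rfl, htab]) (hT.trans hN) ?_).mono ?_
    · intro k2 hk2 τ2 hf2 hτ2 hsub2 _
      have hα := Equiv.apply_symm_apply finFunctionFinEquiv (⟨k1, hk1⟩ : Fin (A.card ^ A.arity i))
      have hβ := Equiv.apply_symm_apply finFunctionFinEquiv (⟨k2, hk2⟩ : Fin (A.card ^ A.arity i))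
      refine (tryStmt_spec (i := i) (α := finFunctionFinEquiv.symm ⟨k1, hk1⟩)
        (β := finFunctionFinEquiv.symm ⟨k2, hk2⟩) hA hb
        (hτ2.congr (fun r hr => by simp [(show r ≠ 19 by lia)]) (by simp)) ?_ ?_ ?_ ?_ ?_).mono ?_
      · simp [hf2.reg rOp rfl, hf1.reg rOp rfl, hop]
      · simp [hf2.reg rArity rfl, hf1.reg rArity rfl, har]
      · simp [hf2.reg rOffset rfl, hf1.reg rOffset rfl, hoff]
      · rw [hα]; simp [hf2.reg rE1 rfl]
      · rw [hβ]; simp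
      · refine fun ρ hρ => hρ.mono le_rfl ?_
        rintro y ⟨α, β, h1, h2, h3, rfl⟩
        have h1' : finFunctionFinEquiv.symm ⟨k1, hk1⟩ = α := by
          rw [Equiv.symm_apply_eq]; exact Fin.ext h1.symm
        have h2' : finFunctionFinEquiv.symm ⟨k2, hk2⟩ = β := by
          rw [Equiv.symm_apply_eq]; exact Fin.ext h2.symm
        rw [h1', h2']
        exact ⟨rfl, fun j => hsub2 (hsub1 (hfs ▸ hsub (h3 j)))⟩
    · refine fun ρ hρ => hρ.mono (Nat.mul_le_mul_right _ hT) ?_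
      rintro y ⟨α, β, h1, h3, rfl⟩
      simp only [Set.mem_iUnion]
      exact ⟨_, (finFunctionFinEquiv β).2, α, β, h1, rfl, h3, rfl⟩
  · intro ρ hρ
    have hρ' := hρ.mono (F' := images A (found A σ) i) (Nat.mul_le_mul_right _ hT) (by
      rintro y ⟨i', α, β, h1, h3, rfl⟩
      obtain rfl := Fin.ext h1
      simp only [Set.mem_iUnion]
      exact ⟨_, (finFunctionFinEquiv α).2, α, β, rfl, h3, rfl⟩)
    refine ⟨hρ'.closing, ?_, ?_, hρ'.subset⟩
    · exact hfs.ge.trans hρ'.found_mono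
    · rw [← hreg _ (by simp)]; exact hρ'.gates_le

/-- The passes of the closure computation reach the closure of what was found before. -/
theorem passes_spec (hA : A.IsIdempotent) (hb : Budget A N K B) (h : Closing S gate₀ G₀ σ) :
    Spec B (.range rPass (.var rCard * .var rCard) passStmt) σ
      (Closed S gate₀ G₀ (N * N * (N * (N * (N * 3))))
        (stage A (found A σ) (A.card * A.card)) σ) := by
  have hcard := h.ready.card
  -- If a pass starts with at least stage `p` found, it ends with at least stage `p + 1` found.
  have hstep : ∀ p P, stage A (found A σ) p ⊆ P →
      stage A (found A σ) (p + 1) ⊆ stage A (found A σ) p ∪ ⋃ i < A.numOps, images A P i := by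
    rintro p P hP y (hy | ⟨i, α, β, h1, rfl⟩)
    · exact Or.inl hy
    · refine Or.inr ?_
      simp only [Set.mem_iUnion]
      exact ⟨i, i.2, i, α, β, rfl, fun j => hP (h1 j), rfl⟩
  refine (Closed.range (N * (N * (N * 3))) (A.card * A.card)
    (fun p => stage A (found A σ) (p + 1)) h (by simp)
    (by simp [hcard, hb.card_le.trans hb.le]) (by simp [hcard]) hb.card_sq_le ?_).mono ?_
  · intro k hk τ hf hτ hsub hF
    have hk' : stage A (found A σ) k ⊆ found A τ := by
      cases k with
      | zero => exact hsub
      | succ k => exact hF k (by lia)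
    refine (passStmt_spec hA hb (hτ.congr (τ := τ.setReg rPass k)
      (fun r hr => by simp [(show r ≠ 21 by lia)]) rfl)).mono fun ρ hρ => ?_
    exact ⟨hρ.closing, hρ.found_mono, hρ.gates_le, (hstep k (found A τ) hk').trans
      (Set.union_subset (hk'.trans hρ.found_mono) hρ.subset)⟩
  · refine fun τ hτ => hτ.mono
      (Nat.mul_le_mul_right _ (Nat.mul_le_mul hb.card_le hb.card_le)) ?_
    have h2 : 0 < A.card * A.card := by have := hb.two_le; positivity
    intro y hy
    simp only [Set.mem_iUnion]
    -- Pass number `p`, counted from 0, yields stage `p + 1`, so the last pass reaches stage n².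
    exact ⟨A.card * A.card - 1, by lia, by rwa [Nat.sub_add_cancel h2]⟩

/-! ### Correcting an operation at one more pair -/

theorem vec_const (a : Fin A.card) : ![a, a, a] = fun _ => a := by
  ext i; fin_cases i <;> rfl

/-- The substitutions used in one round. -/
def target (gate : ℕ → A.Gate) (G t tR q q1 q2 : ℕ) (y z : Fin A.card × Fin A.card) :
    Target A where
  X x := ![vals gate x G q, vals gate x G q1, vals gate x G t]
  Y x := ![vals gate x G q1, vals gate x G q1, vals gate x G t]
  Z x := ![vals gate x G q2, vals gate x G tR, vals gate x G tR]
  e1 := ![y.1, y.2, y.2]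
  e2 := ![z.1, z.1, z.2]

/-- The operation `t` satisfies `t(x, x, y) = y`, and `t(x, y, y) = x` at the first `P` pairs.
The vertex `tR` computes `t(x, y, y)`. -/
structure Outer (gate : ℕ → A.Gate) (G t tR P : ℕ) : Prop where
  lt : t < 3 + G
  ltR : tR < 3 + G
  subst : ∀ x, vals gate x G tR = vals gate ![x 0, x 1, x 1] G t
  left : ∀ c d, vals gate ![c, c, d] G t = d
  right : ∀ y : Fin A.card × Fin A.card, key y < P → vals gate ![y.1, y.2, y.2] G t = y.1

/-- The operation `q` satisfies `q(x, y, y) = x` at the first `P + 1` pairs and `q(x, x, y) = y` at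
the first `D` pairs; `q1` and `q2` are auxiliary. -/
structure Inner (gate : ℕ → A.Gate) (G t q q1 q2 P D : ℕ) : Prop where
  lt : q < 3 + G
  lt1 : q1 < 3 + G
  lt2 : q2 < 3 + G
  subst : ∀ x, vals gate x G q2 = vals gate ![x 0, x 1, x 1] G q
  eq_right : ∀ a b, vals gate ![a, b, b] G q1 = vals gate ![a, b, b] G t
  eq_left : ∀ c d, vals gate ![c, c, d] G q = vals gate ![c, c, d] G q1
  right : ∀ y : Fin A.card × Fin A.card, key y < P + 1 → vals gate ![y.1, y.2, y.2] G q = y.1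
  left : ∀ y : Fin A.card × Fin A.card, key y < D → vals gate ![y.1, y.1, y.2] G q = y.2

theorem Outer.extend {t tR P : ℕ} (h : Outer gate G t tR P) (hG : G ≤ G')
    (hg : ∀ g < G, gate' g = gate g) : Outer gate' G' t tR P where
  lt := h.lt.trans_le (by lia)
  ltR := h.ltR.trans_le (by lia)
  subst x := by rw [vals_extend hG hg h.lt, vals_extend hG hg h.ltR, h.subst]
  left c d := by rw [vals_extend hG hg h.lt, h.left]
  right y hy := by rw [vals_extend hG hg h.lt, h.right y hy]

theorem vals_zero {x : Fin 3 → Fin A.card} : vals gate x G 0 = x 0 := vals_input (by simp)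

theorem Outer.init (gate : ℕ → A.Gate) : Outer gate 0 2 1 0 where
  lt := by simp
  ltR := by simp
  subst x := by rw [vals_input (by simp), vals_input (by simp)]; rfl
  left c d := by rw [vals_input (by simp)]; rfl
  right y hy := absurd hy (by simp)

/-- Start with q = q2 = the first projection and q1 = tR. On (c,c,d) the latter is t(c,c,c) = c, in
agreement with q. -/
theorem Inner.init (hA : A.IsIdempotent) {t tR P : ℕ} (ho : Ordered gate G)
    (h : Outer gate G t tR P) : Inner gate G t 0 tR 0 P 0 where
  lt := by lia
  lt1 := h.ltR
  lt2 := by lia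
  subst x := by rw [vals_zero, vals_zero]; rfl
  eq_right a b := h.subst _
  eq_left c d := by
    rw [h.subst, vals_zero]
    simp only [Matrix.cons_val_zero, Matrix.cons_val_one]
    rw [vec_const, vals_const hA ho c h.lt]
  right y hy := vals_zero
  left y hy := absurd hy (by simp)

/-- Every clause comes from substituting the old identities into r(q,q1,t), r(q1,q1,t), r(q2,tR,tR).
Only the two current pairs use the choice of r; the earlier ones need just its idempotence. -/
theorem Inner.step {t tR q q1 q2 P D v1 v2 v3 : ℕ} {y z : Fin A.card × Fin A.card}
    (ho : Outer gate G t tR P) (hi : Inner gate G t q q1 q2 P D) (hy : key y = P) (hz : key z = D)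
    (hG : G ≤ G') (hg : ∀ g < G, gate' g = gate g)
    (he : Entry (target gate G t tR q q1 q2 y z) gate' G' (y.1, z.2) v1 v2 v3) :
    Inner gate' G' t v1 v2 v3 P (D + 1) := by
  obtain ⟨r, hr, hx⟩ := he.subst
  have hr' : ∀ a, r ![a, a, a] = a := fun a => by rw [vec_const, hr]
  simp only [target] at hx
  refine ⟨he.lt1, he.lt2, he.lt3, fun x => ?_, fun a b => ?_, fun c d => ?_, fun y' hy' => ?_,
    fun z' hz' => ?_⟩
  · rw [(hx _).1, (hx _).2.2, hi.subst, hi.eq_right, ho.subst]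
  -- On (a,b,b) all three arguments of r(q1,q1,t) equal t(a,b,b).
  · rw [(hx _).2.1, hi.eq_right, hr', vals_extend hG hg ho.lt]
  · rw [(hx _).1, (hx _).2.1, hi.eq_left]
  · rcases Nat.lt_succ_iff_lt_or_eq.1 hy' with h | h
    -- At an earlier pair q, q1 and t all take the value `y'.1`.
    · rw [(hx _).1, hi.right y' hy', hi.eq_right, ho.right y' h, hr']
    · obtain rfl := key_injective (h.trans hy.symm)
      exact he.val1
  · rcases Nat.lt_succ_iff_lt_or_eq.1 hz' with h | h
    -- At an earlier pair q, q1 and t all take the value `z'.2`.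
    · rw [(hx _).1, ← hi.eq_left, hi.left z' h, ho.left, hr']
    · obtain rfl := key_injective (h.trans hz.symm)
      exact he.val2

theorem Outer.step {t q q1 q2 P : ℕ} (hi : Inner gate G t q q1 q2 P (A.card * A.card)) :
    Outer gate G q q2 (P + 1) :=
  ⟨hi.lt, hi.lt2, hi.subst, fun c d => hi.left (c, d) (key_lt _), hi.right⟩

/-- The values of the three generators. -/
def gens (gate : ℕ → A.Gate) (G t q q1 : ℕ) (e1 e2 : Fin 3 → Fin A.card) :
    Set (Fin A.card × Fin A.card) :=
  {(vals gate e1 G q, vals gate e2 G q), (vals gate e1 G q1, vals gate e2 G q1),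
    (vals gate e1 G t, vals gate e2 G t)}

/-- Apply the Maltsev operation to the three generators in the order q, q1, t. This is the
completeness of the search: not finding the pair certifies the negative answer. -/
theorem mem_stage_of_isMaltsevTermOp {t tR q q1 q2 P D : ℕ} {y z : Fin A.card × Fin A.card}
    (ho : Outer gate G t tR P) (hi : Inner gate G t q q1 q2 P D) (hy : key y = P)
    {f : (Fin 3 → Fin A.card) → Fin A.card} (hf : A.IsMaltsevTermOp f) :
    (y.1, z.2) ∈ stage A (gens gate G t q q1 ![y.1, y.2, y.2] ![z.1, z.1, z.2])
      (A.card * A.card) := by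
  set e1 := ![y.1, y.2, y.2]
  set e2 := ![z.1, z.1, z.2]
  have h := mem_stage_of_isTermOp (S := gens gate G t q q1 e1 e2) hf.1
    (α := ![vals gate e1 G q, vals gate e1 G q1, vals gate e1 G t])
    (β := ![vals gate e2 G q, vals gate e2 G q1, vals gate e2 G t])
    (by intro j; fin_cases j <;> simp [gens])
  -- The first coordinate becomes f(a,s,s) with s = t(a,b,b), the second f(u,u,d) with u = q(c,c,d).
  rw [hi.eq_right, hi.right y (by lia), ← hi.eq_left, ho.left, (hf.2 _ _).1, (hf.2 _ _).2] at h
  exact h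

/-! ### One round -/

theorem genStmt_spec {S : Target A} {u v w : ℕ} {y : Fin A.card × Fin A.card}
    (hb : Budget A N K B) (hr : Ready A σ) (h : Recorded S gate G σ)
    (hv1 : σ.mem mVal1 (σ.reg u) = y.1) (hv2 : σ.mem mVal2 (σ.reg u) = y.2)
    (he : Entry S gate G y (σ.reg u) (σ.reg v) (σ.reg w)) (hu : u < 14) (hv : v < 14)
    (hw : w < 14) :
    Spec B (genStmt u v w) σ fun τ => Recorded S gate G τ ∧ found A τ = insert y (found A σ) := by
  refine Spec.set_seq_iff.2 ⟨by simp [hr.card, hb.card_le.trans hb.le], ?_⟩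
  exact insertStmt_spec (h.congr rfl rfl rfl rfl) (by simp [hr.card, hv1, hv2, key]) he
    (fun τ hτ => by simp [hτ, (show u ≠ 23 by lia)])
    (fun τ hτ => by simp [hτ, (show v ≠ 23 by lia)])
    (fun τ hτ => by simp [hτ, (show w ≠ 23 by lia)])

/-- The generators are the entries with r a projection: the triples (q,q1,q2), (q1,q1,tR) and
(t,t,tR) are the columns of the three substitutions. -/
theorem closeStmt_spec (hA : A.IsIdempotent) (hb : Budget A N K B) (hr : Ready A σ)
    (hh : Holds σ gate G) {t tR q q1 q2 : ℕ} {y z : Fin A.card × Fin A.card}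
    (ht : σ.reg rT = t) (htR : σ.reg rTR = tR) (hq : σ.reg rQ = q) (hq1 : σ.reg rQ1 = q1)
    (hq2 : σ.reg rQ2 = q2) (lt : t < 3 + G) (ltR : tR < 3 + G) (lq : q < 3 + G) (lq1 : q1 < 3 + G)
    (lq2 : q2 < 3 + G)
    (hv1 : ∀ v < 3 + G, σ.mem mVal1 v = vals gate ![y.1, y.2, y.2] G v)
    (hv2 : ∀ v < 3 + G, σ.mem mVal2 v = vals gate ![z.1, z.1, z.2] G v) :
    Spec B closeStmt σ fun τ =>
      Closing (target gate G t tR q q1 q2 y z) gate G τ ∧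
      τ.reg rGates ≤ G + N * N * (N * (N * (N * 3))) ∧
      stage A (gens gate G t q q1 ![y.1, y.2, y.2] ![z.1, z.1, z.2]) (A.card * A.card) ⊆
        found A τ := by
  set S := target gate G t tR q q1 q2 y z with hS
  set e1 := ![y.1, y.2, y.2] with he1
  set e2 := ![z.1, z.1, z.2] with he2
  subst ht htR hq hq1 hq2
  unfold closeStmt
  refine Spec.seq (R := fun τ => found A τ = ∅)
    (Spec.range (fun k τ => ∀ l < k, τ.mem mFound l = 0) (A.card * A.card)
      (by simp [hr.card, hb.card_le.trans hb.le]) (by simp [hr.card]) hb.card_sq_le (by simp)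
      ?_ ?_) ?_
  · intro k hk τ hf hτ
    simp
    intro l hl
    rcases Nat.le_iff_lt_or_eq.1 hl with h | rfl
    · rw [Function.update_of_ne h.ne, hτ l h]
    · simp
  · intro τ hf hτ
    ext u
    simp [found, hτ _ (key_lt u)]
  intro σ1 f1 h1
  have hrec1 : Recorded S gate G σ1 := fun u hu => by simp [h1] at hu
  have hr1 : Ready A σ1 := hr.congr (f1.reg _ rfl) (f1.reg _ rfl) (f1.mem _ rfl) (f1.mem _ rfl)
    (f1.mem _ rfl)
  refine Spec.seq (genStmt_spec (y := (vals gate e1 G (σ.reg rQ), vals gate e2 G (σ.reg rQ))) hb hr1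
    hrec1 (by rw [f1.mem _ rfl, f1.reg _ rfl, hv1 _ lq]) (by rw [f1.mem _ rfl, f1.reg _ rfl, hv2 _ lq])
    ?_ (by simp) (by simp) (by simp)) fun σ2 f2 h2 => ?_
  · rw [f1.reg _ rfl, f1.reg _ rfl, f1.reg _ rfl]
    exact ⟨lq, lq1, lq2, ⟨fun x => x 0, fun _ => rfl, fun x => ⟨rfl, rfl, rfl⟩⟩, rfl, rfl⟩
  have hr2 : Ready A σ2 := hr1.congr (f2.reg _ rfl) (f2.reg _ rfl) (f2.mem _ rfl) (f2.mem _ rfl)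
    (f2.mem _ rfl)
  refine Spec.seq (genStmt_spec (y := (vals gate e1 G (σ.reg rQ1), vals gate e2 G (σ.reg rQ1))) hb
    hr2 h2.1 (by rw [f2.mem _ rfl, f2.reg _ rfl, f1.mem _ rfl, f1.reg _ rfl, hv1 _ lq1])
    (by rw [f2.mem _ rfl, f2.reg _ rfl, f1.mem _ rfl, f1.reg _ rfl, hv2 _ lq1])
    ?_ (by simp) (by simp) (by simp)) fun σ3 f3 h3 => ?_
  · rw [f2.reg _ rfl, f2.reg _ rfl, f1.reg _ rfl, f1.reg _ rfl]
    exact ⟨lq1, lq1, ltR, ⟨fun x => x 1, fun _ => rfl, fun x => ⟨rfl, rfl, rfl⟩⟩, rfl, rfl⟩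
  have hr3 : Ready A σ3 := hr2.congr (f3.reg _ rfl) (f3.reg _ rfl) (f3.mem _ rfl) (f3.mem _ rfl)
    (f3.mem _ rfl)
  refine Spec.seq (genStmt_spec (y := (vals gate e1 G (σ.reg rT), vals gate e2 G (σ.reg rT))) hb
    hr3 h3.1
    (by rw [f3.mem _ rfl, f3.reg _ rfl, f2.mem _ rfl, f2.reg _ rfl, f1.mem _ rfl, f1.reg _ rfl,
      hv1 _ lt])
    (by rw [f3.mem _ rfl, f3.reg _ rfl, f2.mem _ rfl, f2.reg _ rfl, f1.mem _ rfl, f1.reg _ rfl,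
      hv2 _ lt])
    ?_ (by simp) (by simp) (by simp)) fun σ4 f4 h4 => ?_
  · rw [f3.reg _ rfl, f3.reg _ rfl, f2.reg _ rfl, f2.reg _ rfl, f1.reg _ rfl, f1.reg _ rfl]
    exact ⟨lt, lt, ltR, ⟨fun x => x 2, fun _ => rfl, fun x => ⟨rfl, rfl, rfl⟩⟩, rfl, rfl⟩
  have hr4 : Ready A σ4 := hr3.congr (f4.reg _ rfl) (f4.reg _ rfl) (f4.mem _ rfl) (f4.mem _ rfl)
    (f4.mem _ rfl)
  have hg4 : σ4.reg rGates = σ.reg rGates := by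
    rw [f4.reg _ rfl, f3.reg _ rfl, f2.reg _ rfl, f1.reg _ rfl]
  have hh4 : Holds σ4 gate G := hh.congr hg4
    (by rw [f4.reg _ rfl, f3.reg _ rfl, f2.reg _ rfl, f1.reg _ rfl])
    (by rw [f4.mem _ rfl, f3.mem _ rfl, f2.mem _ rfl, f1.mem _ rfl])
  have hfound : found A σ4 = gens gate G (σ.reg rT) (σ.reg rQ) (σ.reg rQ1) e1 e2 := by
    rw [h4.2, h3.2, h2.2, h1, gens]
    ext u
    simp only [Set.mem_insert_iff, Set.mem_singleton_iff, Set.mem_empty_iff_false, or_false]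
    tauto
  refine (passes_spec hA hb ⟨hr4, gate, G, hh4, le_rfl, fun _ _ => rfl, h4.1⟩).mono fun τ hτ => ?_
  refine ⟨hτ.closing, ?_, hfound ▸ hτ.subset⟩
  rw [← hh.gates, ← hg4]
  exact hτ.gates_le

/-- No invariant on the identities is assumed, only that the registers name vertices. Hence the
loops can run on after a failure, which leaves q, q1, q2 in place. -/
theorem roundStmt_spec (hA : A.IsIdempotent) (hb : Budget A N K B) (hr : Ready A σ)
    (hh : Holds σ gate G) (hG : G ≤ K) {t tR q q1 q2 : ℕ} {y z : Fin A.card × Fin A.card}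
    (ht : σ.reg rT = t) (htR : σ.reg rTR = tR) (hq : σ.reg rQ = q) (hq1 : σ.reg rQ1 = q1)
    (hq2 : σ.reg rQ2 = q2) (lt : t < 3 + G) (ltR : tR < 3 + G) (lq : q < 3 + G) (lq1 : q1 < 3 + G)
    (lq2 : q2 < 3 + G) (ha : σ.reg rA = y.1) (hb' : σ.reg rB = y.2) (hc : σ.reg rC = z.1)
    (hd : σ.reg rD = z.2) :
    Spec B roundStmt σ fun τ => Ready A τ ∧ ∃ gate' G', Holds τ gate' G' ∧ G ≤ G' ∧
      G' ≤ G + N * N * (N * (N * (N * 3))) ∧ (∀ g < G, gate' g = gate g) ∧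
      (τ.reg rFail = σ.reg rFail ∧ Entry (target gate G t tR q q1 q2 y z) gate' G' (y.1, z.2)
          (τ.reg rQ) (τ.reg rQ1) (τ.reg rQ2) ∨
        τ.reg rFail = 1 ∧ τ.reg rQ = q ∧ τ.reg rQ1 = q1 ∧ τ.reg rQ2 = q2 ∧
        (y.1, z.2) ∉ stage A (gens gate G t q q1 ![y.1, y.2, y.2] ![z.1, z.1, z.2])
          (A.card * A.card)) := by
  unfold roundStmt
  refine Spec.seq (evalStmt_spec (x := ![y.1, y.2, y.2]) hb hr hh hG (by simp) ha hb' hb')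
    fun σ1 f1 h1 => ?_
  have hr1 : Ready A σ1 := hr.congr (f1.reg _ rfl) (f1.reg _ rfl) (f1.mem _ rfl) (f1.mem _ rfl)
    (f1.mem _ rfl)
  have hh1 : Holds σ1 gate G := hh.congr (f1.reg _ rfl) (f1.reg _ rfl) (f1.mem _ rfl)
  refine Spec.seq (evalStmt_spec (x := ![z.1, z.1, z.2]) hb hr1 hh1 hG (by simp)
    ((f1.reg _ rfl).trans hc) ((f1.reg _ rfl).trans hc) ((f1.reg _ rfl).trans hd))
    fun σ2 f2 h2 => ?_
  have hr2 : Ready A σ2 := hr1.congr (f2.reg _ rfl) (f2.reg _ rfl) (f2.mem _ rfl) (f2.mem _ rfl)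
    (f2.mem _ rfl)
  have hh2 : Holds σ2 gate G := hh1.congr (f2.reg _ rfl) (f2.reg _ rfl) (f2.mem _ rfl)
  refine Spec.seq (closeStmt_spec hA hb hr2 hh2 (t := t) (tR := tR) (q := q) (q1 := q1) (q2 := q2)
    (y := y) (z := z) (by rw [f2.reg _ rfl, f1.reg _ rfl, ht])
    (by rw [f2.reg _ rfl, f1.reg _ rfl, htR]) (by rw [f2.reg _ rfl, f1.reg _ rfl, hq])
    (by rw [f2.reg _ rfl, f1.reg _ rfl, hq1]) (by rw [f2.reg _ rfl, f1.reg _ rfl, hq2])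
    lt ltR lq lq1 lq2 (by rw [f2.mem _ rfl]; exact h1) h2) fun σ3 f3 ⟨h3, h4, h5⟩ => ?_
  obtain ⟨hr3, gate', G', hh3, hGG, hgate, hrec⟩ := h3
  have reg3 : ∀ r, closeStmt.touches r = false → (evalStmt mVal2 rC rC rD).touches r = false →
      (evalStmt mVal1 rA rB rB).touches r = false → σ3.reg r = σ.reg r := fun r a b c => by
    rw [f3.reg r a, f2.reg r b, f1.reg r c]
  have hk : A.card * (y.1 : ℕ) + z.2 = key (y.1, z.2) := rfl
  have hbound : G' ≤ G + N * N * (N * (N * (N * 3))) := by rw [← hh3.gates]; exact h4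
  simp only [Spec.set_seq_iff, Spec.ite_iff, Spec.set_iff]
  simp [hr3.card, reg3 rA rfl rfl rfl, reg3 rD rfl rfl rfl, ha, hd, hk,
    hb.card_le.trans hb.le, reg3 rFail rfl rfl rfl, reg3 rQ rfl rfl rfl, reg3 rQ1 rfl rfl rfl,
    reg3 rQ2 rfl rfl rfl, hq, hq1, hq2]
  refine ⟨fun hfound => ?_, fun hfound => ?_⟩
  · exact ⟨hr3.congr rfl rfl rfl rfl rfl, gate', G', hh3.congr rfl rfl rfl, hGG, hbound, hgate,
      Or.inl (hrec _ hfound)⟩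
  · exact ⟨hr3.congr rfl rfl rfl rfl rfl, gate', G', hh3.congr rfl rfl rfl, hGG, hbound, hgate,
      Or.inr fun hmem => h5 hmem hfound⟩

/-! ### The search -/

/-- Either no failure has been observed and `p` holds, or there is no Maltsev operation. -/
def Status (A : FinAlgebra) (σ : State) (p : Prop) : Prop :=
  σ.reg rFail = 0 ∧ p ∨ σ.reg rFail ≠ 0 ∧ ¬ ∃ f, A.IsMaltsevTermOp f

/-- The configuration after `P` rounds of the outer loop, if each inner round costs `c` gates. -/
structure OuterState (A : FinAlgebra) (c P : ℕ) (σ : State) : Prop where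
  ready : Ready A σ
  exists_gate : ∃ (gate : ℕ → A.Gate) (G : ℕ), Holds σ gate G ∧ G ≤ P * (A.card * A.card) * c ∧
    σ.reg rT < 3 + G ∧ σ.reg rTR < 3 + G ∧ Status A σ (Outer gate G (σ.reg rT) (σ.reg rTR) P)

/-- The configuration after `D` rounds of the inner loop, if each inner round costs `c` gates. -/
structure InnerState (A : FinAlgebra) (c P D : ℕ) (σ : State) : Prop where
  ready : Ready A σ
  exists_gate : ∃ (gate : ℕ → A.Gate) (G : ℕ), Holds σ gate G ∧
    G ≤ (P * (A.card * A.card) + D) * c ∧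
    σ.reg rT < 3 + G ∧ σ.reg rTR < 3 + G ∧ σ.reg rQ < 3 + G ∧ σ.reg rQ1 < 3 + G ∧
    σ.reg rQ2 < 3 + G ∧ Status A σ (Outer gate G (σ.reg rT) (σ.reg rTR) P ∧
      Inner gate G (σ.reg rT) (σ.reg rQ) (σ.reg rQ1) (σ.reg rQ2) P D)

/-- The pair with a given number. -/
theorem exists_key_eq {k : ℕ} (hk : k < A.card * A.card) :
    ∃ y : Fin A.card × Fin A.card, key y = k ∧ k / A.card = y.1 ∧ k % A.card = y.2 := by
  have h0 : 0 < A.card := Nat.pos_of_ne_zero fun h => by simp [h] at hk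
  exact ⟨(⟨k / A.card, Nat.div_lt_of_lt_mul hk⟩, ⟨k % A.card, Nat.mod_lt _ h0⟩),
    Nat.div_add_mod k A.card, rfl, rfl⟩

/-- The number of gates that one round may add. -/
def roundCost (N : ℕ) : ℕ := N * N * (N * (N * (N * 3)))

theorem rightStmt_spec (hA : A.IsIdempotent) (hb : Budget A N K B)
    (hK : N * N * (N * N) * roundCost N ≤ K) {P : ℕ} (hP : P < A.card * A.card)
    (h : OuterState A (roundCost N) P σ) (hleft : σ.reg rLeft = P) :
    Spec B rightStmt σ (OuterState A (roundCost N) (P + 1)) := by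
  obtain ⟨hr, gate, G, hh, hG, lt, ltR, hst⟩ := h
  have hn0 : 0 < A.card := by have := hb.two_le; lia
  have hnn : A.card * A.card ≤ N * N := Nat.mul_le_mul hb.card_le hb.card_le
  obtain ⟨y, hy, hy1, hy2⟩ := exists_key_eq hP
  unfold rightStmt
  simp only [Spec.set_seq_iff]
  simp [hr.card, hleft, hy1, hy2, hP.le.trans hb.card_sq_le, hn0]
  generalize hσ' : State.setReg _ _ _ = σ'
  have hreg : ∀ r, r ≠ 2 → r ≠ 3 → r ≠ 8 → r ≠ 9 → r ≠ 10 → σ'.reg r = σ.reg r :=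
    fun r h1 h2 h3 h4 h5 => by simp [← hσ', h1, h2, h3, h4, h5]
  have hmem : σ'.mem = σ.mem := by simp [← hσ']
  have ha : σ'.reg rA = y.1 := by simp [← hσ']
  have hb' : σ'.reg rB = y.2 := by simp [← hσ']
  have hr' : Ready A σ' := hr.congr (by simp [hreg]) (by simp [hreg]) (by rw [hmem])
    (by rw [hmem]) (by rw [hmem])
  refine Spec.seq (R := InnerState A (roundCost N) P (A.card * A.card))
    (Spec.range (InnerState A (roundCost N) P) (A.card * A.card)
    (by simp [hr'.card, hb.card_le.trans hb.le]) (by simp [hr'.card]) hb.card_sq_le ?_ ?_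
    fun τ _ hτ => hτ) ?_
  · refine ⟨hr', gate, G, hh.congr (by simp [hreg]) (by simp [hreg]) (by rw [hmem]), by simpa using hG,
      by simpa [hreg] using lt, by simpa [hreg] using ltR, by simp [← hσ'], by simpa [← hσ'] using ltR,
      by simp [← hσ'], ?_⟩
    rcases hst with ⟨h1, h2⟩ | ⟨h1, h2⟩
    · refine Or.inl ⟨by simp [hreg, h1], by simpa [hreg] using h2, ?_⟩
      have := Inner.init hA hh.ordered h2
      simpa [← hσ'] using this
    · exact Or.inr ⟨by simp [hreg, h1], h2⟩
  · intro D hD τ hf hτ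
    obtain ⟨hrτ, gate, G, hh, hG, lt, ltR, lq, lq1, lq2, hst⟩ := hτ
    obtain ⟨z, hz, hz1, hz2⟩ := exists_key_eq hD
    simp only [Spec.set_seq_iff]
    simp [hrτ.card, hz1, hz2, hD.le.trans hb.card_sq_le, hn0]
    generalize hτ' : State.setReg _ _ _ = τ'
    have hreg' : ∀ r, r ≠ 4 → r ≠ 5 → r ≠ 31 → τ'.reg r = τ.reg r :=
      fun r h1 h2 h3 => by simp [← hτ', h1, h2, h3]
    have hmem' : τ'.mem = τ.mem := by simp [← hτ']
    -- At most n⁴ rounds have been made in total, each adding at most `roundCost N` gates.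
    have hGK : G ≤ K := by
      refine hG.trans (le_trans (Nat.mul_le_mul_right _ ?_) hK)
      calc P * (A.card * A.card) + D ≤ (P + 1) * (A.card * A.card) := by
            rw [Nat.succ_mul]; lia
        _ ≤ (A.card * A.card) * (A.card * A.card) := Nat.mul_le_mul_right _ hP
        _ ≤ _ := Nat.mul_le_mul hnn hnn
    refine Spec.mono (Spec.frame (roundStmt_spec (y := y) (z := z) hA hb
      (hrτ.congr (by simp [hreg']) (by simp [hreg']) (by rw [hmem']) (by rw [hmem'])
        (by rw [hmem'])) (hh.congr (by simp [hreg']) (by simp [hreg']) (by rw [hmem'])) hGK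
      (hreg' rT (by simp) (by simp) (by simp)) (hreg' rTR (by simp) (by simp) (by simp))
      (hreg' rQ (by simp) (by simp) (by simp)) (hreg' rQ1 (by simp) (by simp) (by simp))
      (hreg' rQ2 (by simp) (by simp) (by simp)) lt ltR lq lq1 lq2
      (by rw [hreg' _ (by simp) (by simp) (by simp), hf.reg _ rfl, ha])
      (by rw [hreg' _ (by simp) (by simp) (by simp), hf.reg _ rfl, hb'])
      (by simp [← hτ']) (by simp [← hτ']))) ?_
    rintro ρ ⟨⟨hrρ, gate', G', hh', hGG, hGc, hg, hres⟩, hfρ⟩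
    have hT : ρ.reg rT = τ.reg rT := by
      rw [hfρ.reg _ rfl, hreg' _ (by simp) (by simp) (by simp)]
    have hTR : ρ.reg rTR = τ.reg rTR := by
      rw [hfρ.reg _ rfl, hreg' _ (by simp) (by simp) (by simp)]
    have hfail : τ'.reg rFail = τ.reg rFail := hreg' _ (by simp) (by simp) (by simp)
    have hle : 3 + G ≤ 3 + G' := by lia
    refine ⟨hrρ, gate', G', hh', ?_, ?_⟩
    · rw [← add_assoc, Nat.succ_mul]
      exact hGc.trans (Nat.add_le_add_right hG _)
    rw [hT, hTR]
    refine ⟨lt.trans_le hle, ltR.trans_le hle, ?_⟩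
    rcases hres with ⟨h1, h2⟩ | ⟨h1, h2, h3, h4, h5⟩
    · refine ⟨h2.lt1, h2.lt2, h2.lt3, ?_⟩
      unfold Status
      rw [h1, hfail]
      rcases hst with ⟨h0, ho, hi⟩ | h0
      · exact Or.inl ⟨h0, ho.extend hGG hg, hi.step ho hy hz hGG hg h2⟩
      · exact Or.inr h0
    · rw [h2, h3, h4]
      refine ⟨lq.trans_le hle, lq1.trans_le hle, lq2.trans_le hle, Or.inr ⟨by simp [h1], ?_⟩⟩
      -- A first failure occurs while the invariants hold and so refutes a Maltsev operation; a
      -- later one inherits the refutation.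
      rcases hst with ⟨h0, ho, hi⟩ | h0
      · rintro ⟨f, hf⟩
        exact h5 (mem_stage_of_isMaltsevTermOp ho hi hy hf)
      · exact h0.2
  · intro τ hf hτ
    obtain ⟨hrτ, gate, G, hh, hG, lt, ltR, lq, lq1, lq2, hst⟩ := hτ
    simp only [Spec.set_seq_iff, Spec.set_iff]
    simp
    refine ⟨hrτ.congr rfl rfl rfl rfl rfl, gate, G, hh.congr rfl rfl rfl, ?_, by simpa using lq,
      by simpa using lq2, ?_⟩
    · rw [Nat.succ_mul]; exact hG
    · rcases hst with ⟨h0, ho, hi⟩ | h0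
      · exact Or.inl ⟨by simpa using h0, by simpa using Outer.step hi⟩
      · exact Or.inr (by simpa using h0)

theorem searchStmt_spec (hA : A.IsIdempotent) (hb : Budget A N K B)
    (hK : N * N * (N * N) * roundCost N ≤ K) (h0 : 0 < A.numOps) (hr : Ready A σ)
    (hG : σ.reg rGates = 0) (hL : σ.reg rLen = 0) (hF : σ.reg rFail = 0) :
    Spec B searchStmt σ (OuterState A (roundCost N) (A.card * A.card)) := by
  unfold searchStmt
  simp only [Spec.set_seq_iff]
  simp
  generalize hσ' : State.setReg _ _ _ = σ'
  have hmem : σ'.mem = σ.mem := by simp [← hσ']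
  have hr' : Ready A σ' := hr.congr (by simp [← hσ']) (by simp [← hσ']) (by rw [hmem])
    (by rw [hmem]) (by rw [hmem])
  refine Spec.range (OuterState A (roundCost N)) (A.card * A.card)
    (by simp [hr'.card, hb.card_le.trans hb.le]) (by simp [hr'.card]) hb.card_sq_le ?_ ?_
    fun τ _ hτ => hτ
  · refine ⟨hr', fun _ => ⟨⟨0, h0⟩, fun _ => 0⟩, 0, ⟨fun g hg => absurd hg (by simp),
      by simp [← hσ', hG], by simp [← hσ', hL, pos], fun g hg => absurd hg (by simp),
      fun g hg => absurd hg (by simp)⟩, by simp, by simp [← hσ'], by simp [← hσ'],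
      Or.inl ⟨by simp [← hσ', hF], ?_⟩⟩
    simpa [← hσ'] using Outer.init _
  · intro P hP τ hf hτ
    obtain ⟨hrτ, gate, G, hh, hG, lt, ltR, hst⟩ := hτ
    exact rightStmt_spec hA hb hK hP ⟨hrτ.congr rfl rfl rfl rfl rfl, gate, G, hh.congr rfl rfl rfl,
      hG, by simpa using lt, by simpa using ltR, by simpa [Status] using hst⟩ (by simp)

/-! ### Input and output -/

theorem prelude_spec (hb : Budget A N K B) (hc : σ.reg rCard = A.card)
    (hk : σ.reg rOps = A.numOps) (hin : ∀ e, σ.mem mInput e = A.code.getD e 0) :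
    Spec B prelude σ (Ready A) := by
  have hN := hb.le
  unfold prelude
  simp only [Spec.set_seq_iff]
  simp [hk]
  generalize hσ' : State.setReg _ _ _ = σ'
  refine Spec.range (fun i τ => τ.reg rPos = A.tablePos i ∧
    (∀ l < i, τ.mem mOffset l = A.tablePos l) ∧ ∀ l < i, τ.mem mTable l = A.tableSize l)
    A.numOps (by simp) (by simp [← hσ', hk]) (hb.numOps_le.trans hN) ?_ ?_ ?_
  · simp [← hσ', tablePos]
  · intro i hi τ hf ⟨h1, h2, h3⟩
    have har := code_getD_arity (⟨i, hi⟩ : Fin A.numOps)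
    have hsize := tableSize_fin (⟨i, hi⟩ : Fin A.numOps)
    have hcard : τ.reg rCard = A.card := by rw [hf.reg _ rfl]; simp [← hσ', hc]
    have hinput : ∀ e, τ.mem mInput e = A.code.getD e 0 := by
      rw [hf.mem _ rfl, ← hσ']; exact hin
    simp only [Spec.set_seq_iff]
    simp
    generalize hτ' : State.setReg (State.setReg _ _ _) _ _ = τ'
    refine Spec.seq (R := fun ρ => ρ.reg rPow = A.tableSize i)
      (Spec.range (fun j ρ => ρ.reg rPow = A.card ^ j) (A.arity ⟨i, hi⟩) (by simp) ?_
      ((hb.arity_le _).trans hN) (by simp [← hτ']) ?_ ?_) ?_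
    · simpa [← hτ', hinput] using har
    · intro j hj ρ hfρ hρ
      have : ρ.reg rCard = A.card := by rw [hfρ.reg _ rfl]; simp [← hτ', hcard]
      simp [this, hρ, hb.card_le.trans hN, pow_succ']
    · intro ρ _ hρ
      rw [hρ, hsize]
    · intro ρ hfρ hρ
      have hm : ρ.mem = τ.mem := by
        funext a
        rw [hfρ.mem a rfl]; simp [← hτ']
      have hi' : ρ.reg rOp = i := by rw [hfρ.reg _ rfl]; simp [← hτ']
      have hp : ρ.reg rPos = A.tablePos i := by rw [hfρ.reg _ rfl]; simp [← hτ', h1]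
      simp only [Spec.store_seq_iff, Spec.set_iff]
      simp [hm, hi', hp, hρ]
      refine ⟨by rw [tablePos, tablePos, Finset.sum_range_succ]; lia, fun l hl => ?_, fun l hl => ?_⟩
      · rcases Nat.le_iff_lt_or_eq.1 hl with h | rfl
        · rw [Function.update_of_ne h.ne, h2 l h]
        · simp
      · rcases Nat.le_iff_lt_or_eq.1 hl with h | rfl
        · rw [Function.update_of_ne h.ne, h3 l h]
        · simp
  · intro τ hf ⟨h1, h2, h3⟩
    refine ⟨by rw [hf.reg _ rfl]; simp [← hσ', hc], by rw [hf.reg _ rfl]; simp [← hσ', hk],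
      by rw [hf.mem _ rfl, ← hσ']; exact hin, fun i => h2 i i.2, fun i => ?_⟩
    rw [h3 i i.2, tableSize_fin]

/-- The array of descriptions holds the description of the circuit. -/
theorem Holds.map_range (h : Holds σ gate G) :
    (List.range (pos gate G)).map (σ.mem mDesc) =
      (List.range G).flatMap fun g => gateCode (gate g) := by
  suffices ∀ g ≤ G, (List.range (pos gate g)).map (σ.mem mDesc) =
      (List.range g).flatMap fun g => gateCode (gate g) from this G le_rfl
  intro g hg
  induction g with
  | zero => rfl
  | succ g ih =>
    rw [pos, List.range_add, List.map_append, ih (by lia), List.range_succ, List.flatMap_append,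
      List.flatMap_singleton]
    congr 1
    rw [gateCode, add_comm 1, List.range_succ_eq_map, List.map_cons, List.map_cons, add_zero,
      h.label g hg]
    congr 1
    refine List.ext_getElem (by simp) fun j h1 h2 => ?_
    have := h.nbr g hg ⟨j, by simpa using h1⟩
    simp only [List.getElem_map, List.getElem_range, List.getElem_ofFn]
    rw [← this]
    congr 1
    simp only []
    lia

/-- The correct results of the search, with a bound for the number of gates. -/
def Result (A : FinAlgebra) (K : ℕ) (out : List ℕ) : Prop :=
  (out = [0] ∧ ¬ ∃ f : (Fin 3 → Fin A.card) → Fin A.card, A.IsMaltsevTermOp f) ∨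
    ∃ C : A.Circuit 3, out = 1 :: C.code ∧ A.IsMaltsevTermOp C.fn ∧ C.size ≤ 3 + K

theorem result_of_circuit {t : ℕ} {out : List ℕ} (ho : Ordered gate G) (ht : t < 3 + G)
    (hG : G ≤ K)
    (hM : ∀ x y, vals gate ![x, x, y] G t = y ∧ vals gate ![y, x, x] G t = y)
    (hout : out = 1 :: G :: ((List.range G).flatMap (fun g => gateCode (gate g)) ++ [t])) :
    Result A K out := by
  refine Or.inr ⟨toCircuit gate ho ht, by rw [hout, toCircuit_code], ?_, ?_⟩
  · rw [toCircuit_fn]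
    exact ⟨vals_isTermOp ho ht, hM⟩
  · exact Nat.add_le_add_left hG 3

theorem outputStmt_spec {c : ℕ} (hb : Budget A N K B) (hK : A.card * A.card * (A.card * A.card) * c ≤ K)
    (h : OuterState A c (A.card * A.card) σ) (hout : σ.out = []) :
    Spec B outputStmt σ fun τ => Result A K τ.out := by
  obtain ⟨hr, gate, G, hh, hG, lt, ltR, hst⟩ := h
  have hGK := hG.trans hK
  -- The output loop runs over all description cells, at most `N + 1` per gate.
  have hlen : pos gate G ≤ B := (pos_le hb.arity_le gate G).trans
    ((Nat.mul_le_mul_right _ hGK).trans hb.gates_le)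
  unfold outputStmt
  refine Spec.ite_iff.2 ⟨by simp, fun hc => ?_, fun hc => ?_⟩
  · rcases hst with ⟨h0, -⟩ | ⟨-, hno⟩
    · exact absurd h0 hc
    · simp only [Spec.write_iff]
      exact ⟨by simp, Or.inl ⟨by simp [hout], hno⟩⟩
  · rcases hst with ⟨-, ho⟩ | ⟨h0, -⟩
    · simp only [Spec.write_seq_iff]
      simp [hh.gates]
      generalize hσ' : State.emit _ _ = σ'
      have hmem : σ'.mem = σ.mem := by simp [← hσ']
      have hreg : σ'.reg = σ.reg := by simp [← hσ']
      refine Spec.seq (R := fun τ => τ.out = [1, G] ++ (List.range (pos gate G)).map (σ.mem mDesc))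
        (Spec.range (fun p τ => τ.out = [1, G] ++ (List.range p).map (σ.mem mDesc)) (pos gate G)
        (by simp) (by simp [hreg, hh.len]) hlen (by simp [← hσ', hout]) ?_ fun τ _ hτ => hτ) ?_
      · intro p hp τ hf hτ
        have : τ.mem mDesc = σ.mem mDesc := by rw [hf.mem _ rfl, hmem]
        simp [hτ, this, List.range_succ]
      · intro τ hf hτ
        refine Spec.write_iff.2 ⟨by simp, result_of_circuit hh.ordered lt hGK (fun x y =>
          ⟨ho.left x y, ho.right (y, x) (key_lt _)⟩) ?_⟩
        have : τ.reg rT = σ.reg rT := by rw [hf.reg _ rfl, hreg]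
        simp [hτ, hh.map_range, this]
    · exact absurd hc h0

theorem mainStmt_spec (hA : A.IsIdempotent) (h0 : 0 < A.numOps)
    (hb : 2 ≤ A.card → Budget A N K B) (hK : N * N * (N * N) * roundCost N ≤ K) :
    Spec B mainStmt (init A.code) fun τ => Result A K τ.out := by
  unfold mainStmt
  simp only [Spec.set_seq_iff, Spec.ite_iff, Spec.write_seq_iff, Spec.write_iff]
  simp [init, code_getD_zero, code_getD_one]
  refine ⟨fun h => ?_, fun h => ?_⟩
  · have h2 : 2 ≤ A.card := by
      change A.card - 1 ≠ 0 at h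
      lia
    have hb := hb h2
    have hnn : A.card * A.card ≤ N * N := Nat.mul_le_mul hb.card_le hb.card_le
    refine Spec.seq (prelude_spec hb ?_ ?_ ?_) fun σ1 f1 h1 => ?_
    · rfl
    · rfl
    · intro e; rfl
    refine Spec.seq (searchStmt_spec hA hb hK h0 h1 (f1.reg _ rfl) (f1.reg _ rfl) (f1.reg _ rfl))
      fun σ2 f2 h2 => ?_
    exact outputStmt_spec hb ((Nat.mul_le_mul_right _ (Nat.mul_le_mul hnn hnn)).trans hK) h2
      ((f2.out rfl).trans (f1.out rfl))
  -- With at most one element every identity holds, so the third input is already a Maltsev term. No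
  -- arity or table is read.
  · have h1 : A.card ≤ 1 := by
      change A.card - 1 = 0 at h
      lia
    have : Subsingleton (Fin A.card) := Fin.subsingleton_iff_le_one.2 h1
    refine result_of_circuit (gate := fun _ => ⟨⟨0, h0⟩, fun _ => 0⟩) (G := 0) (t := 2)
      (fun g hg => absurd hg (by simp)) (by simp) (by simp)
      (fun x y => ⟨Subsingleton.elim _ _, Subsingleton.elim _ _⟩) ?_
    simp

/-- The number of gates of the circuit found for an algebra of size `N`. -/
def gateBound (N : ℕ) : ℕ := N * N * (N * N) * roundCost N

/-- All ranges occurring in the computation for an algebra of size `N` are at most this. -/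
def rangeBound (N : ℕ) : ℕ := gateBound N * (N + 1) + N * N

theorem polyFun_gateBound : PolyFun gateBound :=
  have h2 := PolyFun.id.mul PolyFun.id
  (h2.mul h2).mul (h2.mul (PolyFun.id.mul (PolyFun.id.mul (PolyFun.id.mul (PolyFun.const 3)))))

theorem polyFun_rangeBound : PolyFun rangeBound :=
  (polyFun_gateBound.mul (PolyFun.id.add (PolyFun.const 1))).add (PolyFun.id.mul PolyFun.id)

end MaltsevSearch

/-! ### The polynomial bound for time and circuit size -/

theorem theorem4p2 :
    ∃ (P : RAM.Prog) (p : Polynomial ℕ), ∀ A : FinAlgebra,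
      0 < A.numOps → (∀ i : Fin A.numOps, 0 < A.arity i) → A.IsIdempotent →
      ∃ (τ : RAM.State) (t : ℕ),
        RAM.Exec P (RAM.init A.code) τ t ∧ t ≤ p.eval A.size ∧
        ((τ.out = [0] ∧ ¬ ∃ f : (Fin 3 → Fin A.card) → Fin A.card, A.IsMaltsevTermOp f) ∨
          ∃ C : A.Circuit 3, τ.out = 1 :: C.code ∧ A.IsMaltsevTermOp C.fn ∧
            C.size ≤ p.eval A.size) := by
  open MaltsevSearch in
  -- One polynomial bounds both: the running time plus the circuit size, where 3 accounts for the
  -- inputs.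
  obtain ⟨p, hp⟩ := (mainStmt.polyFun_cost.comp polyFun_rangeBound).add
    ((RAM.PolyFun.const 3).add polyFun_gateBound)
  -- The program uses registers 0 to 31, so scratch space starts at 32.
  refine ⟨mainStmt.comp 32, p, fun A h0 ha hA => ?_⟩
  have hspec : RAM.Spec (rangeBound A.size) mainStmt (RAM.init A.code)
      fun τ => Result A (gateBound A.size) τ.out :=
    mainStmt_spec hA h0 (fun h2 => ⟨h2, card_le_size h0 ha, numOps_le_size h2, arity_le_size h2,
      tableSize_le_size, Nat.le_add_left _ _, Nat.le_add_right _ _⟩) le_rfl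
  obtain ⟨τ, t, he, ht, hτ⟩ := RAM.Stmt.comp_runs (d := 32) (by decide) hspec.1
  have hres : Result A (gateBound A.size) τ.out := hτ.out ▸ hspec.2
  refine ⟨τ, t, he, by rw [← hp]; lia, ?_⟩
  rcases hres with h | ⟨C, h1, h2, h3⟩
  · exact Or.inl h
  · exact Or.inr ⟨C, h1, h2, by rw [← hp]; lia⟩
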